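/- Let $q$ be an indeterminate; all algebras are associative unital algebras over $\mathbb{C}(q)$. Let $d\ge n\ge 3$ be integers. The Yokonuma–Hecke algebra $\mathrm{Y}_{d,n}(q)$ is generated by $g_1,\dots,g_{n-1},t_1,\dots,t_n$ subject to $g_ig_j=g_jg_i$ for $|i-j|>1$, $g_ig_jg_i=g_jg_ig_j$ for $|i-j|=1$, $t_i^d=1$, $t_it_j=t_jt_i$, $g_it_j=t_{s_i(j)}g_i$ (where $s_i=(i\ i{+}1)$) and $g_i^2=1+(q-q^{-1})e_ig_i$, where $e_i=\frac1d\sum_{s=0}^{d-1}t_i^st_{i+1}^{d-s}$. Let $\mathrm{Y}^{(\mathrm{br})}_{d,n}(q)$ be its subalgebra generated by $g_1,\dots,g_{n-1}$; it contains the $e_i$. Put $g_{1,2}=1+q(g_1+g_2)+q^2(g_1g_2+g_2g_1)+q^3g_1g_2g_1$. Let $\mathrm{FTL}_{d,n}(q)=\mathrm{Y}_{d,n}(q)/\langle e_1e_2g_{1,2}\rangle$, with natural projection $p:\mathrm{Y}_{d,n}(q)\to\mathrm{FTL}_{d,n}(q)$. The algebra of braids and ties $\mathcal{E}_n(q)$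 is generated by $b_1,\dots,b_{n-1},\epsilon_1,\dots,\epsilon_{n-1}$ subject to $b_ib_{i+1}b_i=b_{i+1}b_ib_{i+1}$; $b_ib_j=b_jb_i$, $\epsilon_i\epsilon_j=\epsilon_j\epsilon_i$ and $\epsilon_ib_j=b_j\epsilon_i$ for $|i-j|>1$; $\epsilon_i^2=\epsilon_i$; $\epsilon_ib_i=b_i\epsilon_i$; $\epsilon_i\epsilon_jb_i=b_i\epsilon_i\epsilon_j=\epsilon_jb_i\epsilon_j$ and $\epsilon_ib_jb_i=b_jb_i\epsilon_j$ for $|i-j|=1$; and $b_i^2=1+(q-q^{-1})\epsilon_ib_i$. With $b_{1,2}=1+q(b_1+b_2)+q^2(b_1b_2+b_2b_1)+q^3b_1b_2b_1$, the partition Temperley–Lieb algebra is $\mathrm{PTL}_n(q)=\mathcal{E}_n(q)/\langle\epsilon_1\epsilon_2b_{1,2}\rangle$. **Proposition.** There are algebra isomorphisms $$\Phi:\mathrm{PTL}_n(q)\to \mathrm{Y}^{(\mathrm{br})}_{d,n}(q)/\langle e_1e_2g_{1,2}\rangle,\qquad \Psi:\mathrm{PTL}_n(q)\to p\big(\mathrm{Y}^{(\mathrm{br})}_{d,n}(q)\big),$$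 where the first ideal is the two-sided ideal of $\mathrm{Y}^{(\mathrm{br})}_{d,n}(q)$ and $p(\mathrm{Y}^{(\mathrm{br})}_{d,n}(q))$ is the subalgebra of $\mathrm{FTL}_{d,n}(q)$ generated by the images of the $g_i$; both send the class of $b_i$ to the class of $g_i$ and the class of $\epsilon_i$ to the class of $e_i$, for $1\le i\le n-1$. Moreover $\Psi\circ\Phi^{-1}$ sends the class of $y\in \mathrm{Y}^{(\mathrm{br})}_{d,n}(q)$ to $p(y)$. In this sense both algebras are $\mathrm{FTL}^{(\mathrm{br})}_{d,n}(q)$, and $\mathrm{PTL}_n(q)\cong\mathrm{FTL}^{(\mathrm{br})}_{d,n}(q)$. -/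

import Mathlib

namespace BraidsTies

/-- The ground field `ℂ(q)`. -/
abbrev K : Type := RatFunc ℂ

/-- The indeterminate `q` of `ℂ(q)`. -/
noncomputable def q : K := RatFunc.X

/-- `|i - j| > 1`. -/
def Far {m : ℕ} (i j : Fin m) : Prop := (i : ℕ) + 1 < j ∨ (j : ℕ) + 1 < i

/-- `|i - j| = 1`. -/
def Near {m : ℕ} (i j : Fin m) : Prop := (i : ℕ) + 1 = j ∨ (j : ℕ) + 1 = i

/-- `x y · (1 + q (a + b) + q² (a b + b a) + q³ a b a)`: with `x = e₁`, `y = e₂`, `a = g₁`, `b = g₂`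
this is `e₁ e₂ g_{1,2}`. -/
noncomputable def tlElement {A : Type} [Ring A] [Algebra K A] (x y a b : A) : A :=
  x * y * (1 + q • (a + b) + q ^ 2 • (a * b + b * a) + q ^ 3 • (a * b * a))

/-- The quotient of a `ℂ(q)`-algebra by the two-sided ideal generated by one element. -/
abbrev PrincipalQuotient {A : Type} [Ring A] (x : A) : Type :=
  (TwoSidedIdeal.span {x}).ringCon.Quotient

/-- The natural projection `A → A / ⟨x⟩`. -/
noncomputable def proj {A : Type} [Ring A] [Algebra K A] (x : A) : A →ₐ[K] PrincipalQuotient x :=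
  (TwoSidedIdeal.span {x}).ringCon.mkₐ K

/-- The first index of `Fin (n - 1)`, i.e. the index "1" of the generators `b₁`, `g₁`, …
(indices are shifted by one). -/
def idx₁ {n : ℕ} (hn : 3 ≤ n) : Fin (n - 1) := ⟨0, by omega⟩

/-- The second index of `Fin (n - 1)`. -/
def idx₂ {n : ℕ} (hn : 3 ≤ n) : Fin (n - 1) := ⟨1, by omega⟩

/-! ### The algebra of braids and ties -/

/-- The generators `b_i`, `ε_i`, `1 ≤ i ≤ n - 1`. -/
inductive BTGen (n : ℕ) : Type
  | b (i : Fin (n - 1))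
  | ε (i : Fin (n - 1))

namespace BTGen

/-- `b_i` in the free algebra. -/
noncomputable abbrev fb {n : ℕ} (i : Fin (n - 1)) : FreeAlgebra K (BTGen n) :=
  FreeAlgebra.ι K (BTGen.b i)

/-- `ε_i` in the free algebra. -/
noncomputable abbrev fε {n : ℕ} (i : Fin (n - 1)) : FreeAlgebra K (BTGen n) :=
  FreeAlgebra.ι K (BTGen.ε i)

end BTGen

open BTGen in
/-- The defining relations of the algebra of braids and ties. -/
inductive BTRel (n : ℕ) : FreeAlgebra K (BTGen n) → FreeAlgebra K (BTGen n) → Prop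
  | braid (i j : Fin (n - 1)) (h : (i : ℕ) + 1 = j) :
      BTRel n (fb i * fb j * fb i) (fb j * fb i * fb j)
  | bb_far (i j : Fin (n - 1)) (h : Far i j) : BTRel n (fb i * fb j) (fb j * fb i)
  | εε_far (i j : Fin (n - 1)) (h : Far i j) : BTRel n (fε i * fε j) (fε j * fε i)
  | ε_sq (i : Fin (n - 1)) : BTRel n (fε i ^ 2) (fε i)
  | εb_same (i : Fin (n - 1)) : BTRel n (fε i * fb i) (fb i * fε i)
  | εb_far (i j : Fin (n - 1)) (h : Far i j) : BTRel n (fε i * fb j) (fb j * fε i)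
  | εεb_left (i j : Fin (n - 1)) (h : Near i j) :
      BTRel n (fε i * fε j * fb i) (fb i * fε i * fε j)
  | εεb_right (i j : Fin (n - 1)) (h : Near i j) :
      BTRel n (fb i * fε i * fε j) (fε j * fb i * fε j)
  | εbb (i j : Fin (n - 1)) (h : Near i j) :
      BTRel n (fε i * fb j * fb i) (fb j * fb i * fε j)
  | quadratic (i : Fin (n - 1)) :
      BTRel n (fb i ^ 2) (1 + (q - q⁻¹) • (fε i * fb i))

/-- The algebra of braids and ties `E_n(q)`. -/
abbrev BT (n : ℕ) : Type := RingQuot (BTRel n)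

namespace BT

/-- The generator `b_i` of `E_n(q)`. -/
noncomputable def b {n : ℕ} (i : Fin (n - 1)) : BT n :=
  RingQuot.mkAlgHom K (BTRel n) (BTGen.fb i)

/-- The generator `ε_i` of `E_n(q)`. -/
noncomputable def ε {n : ℕ} (i : Fin (n - 1)) : BT n :=
  RingQuot.mkAlgHom K (BTRel n) (BTGen.fε i)

/-- `ε₁ ε₂ b_{1,2}`. -/
noncomputable def tl {n : ℕ} (hn : 3 ≤ n) : BT n :=
  tlElement (ε (idx₁ hn)) (ε (idx₂ hn)) (b (idx₁ hn)) (b (idx₂ hn))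

end BT

/-- The partition Temperley–Lieb algebra `PTL_n(q) = E_n(q) / ⟨ε₁ ε₂ b_{1,2}⟩`. -/
abbrev PTL {n : ℕ} (hn : 3 ≤ n) : Type := PrincipalQuotient (BT.tl hn)

/-! ### The Yokonuma–Hecke algebra -/

/-- The generators `g_i`, `1 ≤ i ≤ n - 1`, and `t_j`, `1 ≤ j ≤ n`. -/
inductive YHGen (n : ℕ) : Type
  | g (i : Fin (n - 1))
  | t (j : Fin n)

/-- `i` as a strand. -/
def lo {n : ℕ} (i : Fin (n - 1)) : Fin n := ⟨i, by omega⟩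

/-- `i + 1` as a strand. -/
def hi {n : ℕ} (i : Fin (n - 1)) : Fin n := ⟨i + 1, by omega⟩

/-- `(1 / d) ∑_{s = 0}^{d - 1} xˢ y^{d - s}`: with `x = t_i`, `y = t_{i+1}` this is `e_i`. -/
noncomputable def avg {A : Type} [Ring A] [Algebra K A] (d : ℕ) (x y : A) : A :=
  (d : K)⁻¹ • ∑ s ∈ Finset.range d, x ^ s * y ^ (d - s)

namespace YHGen

/-- `g_i` in the free algebra. -/
noncomputable abbrev fg {n : ℕ} (i : Fin (n - 1)) : FreeAlgebra K (YHGen n) :=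
  FreeAlgebra.ι K (YHGen.g i)

/-- `t_j` in the free algebra. -/
noncomputable abbrev ft {n : ℕ} (j : Fin n) : FreeAlgebra K (YHGen n) :=
  FreeAlgebra.ι K (YHGen.t j)

end YHGen

open YHGen in
/-- The defining relations of the Yokonuma–Hecke algebra. -/
inductive YHRel (d n : ℕ) : FreeAlgebra K (YHGen n) → FreeAlgebra K (YHGen n) → Prop
  | gg_far (i j : Fin (n - 1)) (h : Far i j) : YHRel d n (fg i * fg j) (fg j * fg i)
  | braid (i j : Fin (n - 1)) (h : Near i j) :
      YHRel d n (fg i * fg j * fg i) (fg j * fg i * fg j)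
  | t_pow (j : Fin n) : YHRel d n (ft j ^ d) 1
  | tt (i j : Fin n) : YHRel d n (ft i * ft j) (ft j * ft i)
  | gt (i : Fin (n - 1)) (j : Fin n) :
      YHRel d n (fg i * ft j) (ft (Equiv.swap (lo i) (hi i) j) * fg i)
  | quadratic (i : Fin (n - 1)) :
      YHRel d n (fg i ^ 2) (1 + (q - q⁻¹) • (avg d (ft (lo i)) (ft (hi i)) * fg i))

/-- The Yokonuma–Hecke algebra `Y_{d,n}(q)`. -/
abbrev YH (d n : ℕ) : Type := RingQuot (YHRel d n)

namespace YH

/-- The braiding generator `g_i`. -/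
noncomputable def g (d : ℕ) {n : ℕ} (i : Fin (n - 1)) : YH d n :=
  RingQuot.mkAlgHom K (YHRel d n) (YHGen.fg i)

/-- The framing generator `t_j`. -/
noncomputable def t (d : ℕ) {n : ℕ} (j : Fin n) : YH d n :=
  RingQuot.mkAlgHom K (YHRel d n) (YHGen.ft j)

/-- The idempotent `e_i = (1 / d) ∑_s t_iˢ t_{i+1}^{d - s}`. -/
noncomputable def e (d : ℕ) {n : ℕ} (i : Fin (n - 1)) : YH d n :=
  avg d (t d (lo i)) (t d (hi i))

/-- `e₁ e₂ g_{1,2}`. -/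
noncomputable def tl (d : ℕ) {n : ℕ} (hn : 3 ≤ n) : YH d n :=
  tlElement (e d (idx₁ hn)) (e d (idx₂ hn)) (g d (idx₁ hn)) (g d (idx₂ hn))

end YH

/-- `Y^{(br)}_{d,n}(q)`: the subalgebra of `Y_{d,n}(q)` generated by the `g_i`. -/
noncomputable def YHbr (d n : ℕ) : Subalgebra K (YH d n) :=
  Algebra.adjoin K (Set.range (YH.g d (n := n)))

/-! ### The `e_i` lie in `Y^{(br)}_{d,n}(q)` -/

theorem q_sub_inv_ne_zero : q - q⁻¹ ≠ 0 := by
  have hq : q ≠ 0 := RatFunc.X_ne_zero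
  intro h
  have h2 : (RatFunc.X : K) ^ 2 = 1 := by
    have : q * (q - q⁻¹) = 0 := by rw [h, mul_zero]
    rw [mul_sub, mul_inv_cancel₀ hq, sub_eq_zero] at this
    rw [pow_two]; exact this
  have h3 : algebraMap (Polynomial ℂ) K (Polynomial.X ^ 2) = algebraMap (Polynomial ℂ) K 1 := by
    rw [map_pow, RatFunc.algebraMap_X, map_one, h2]
  have h4 := RatFunc.algebraMap_injective ℂ h3
  have h5 := congrArg (Polynomial.eval 0) h4
  simp at h5

theorem avg_mul_self {A : Type} [Ring A] [Algebra K A] (d : ℕ) (x y : A) (hxy : Commute x y)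
    (hx : x ^ d = 1) (hy : y ^ d = 1) : avg d x y * avg d x y = avg d x y := by
  rcases Nat.eq_zero_or_pos d with rfl | hd
  · simp [avg]
  obtain ⟨v, hv⟩ : ∃ v : A, v = x * y ^ (d - 1) := ⟨_, rfl⟩
  have hvs : ∀ s ≤ d, x ^ s * y ^ (d - s) = v ^ s := by
    intro s hs
    rw [hv, (hxy.pow_right (d - 1)).mul_pow, ← pow_mul]
    congr 1
    calc y ^ (d - s) = y ^ (d - s) * (y ^ d) ^ (s - 1) := by rw [hy, one_pow, mul_one]
      _ = y ^ ((d - 1) * s) := by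
        rcases s with _ | s
        · simp [hy]
        rw [← pow_mul, ← pow_add]
        congr 1
        obtain ⟨c, rfl⟩ := Nat.exists_eq_add_of_le hs
        have h1 : s + 1 + c - (s + 1) = c := by omega
        have h2 : s + 1 + c - 1 = s + c := by omega
        rw [h1, h2]
        simp only [Nat.add_sub_cancel]
        ring
  have hvd : v ^ d = 1 := by
    rw [← hvs d le_rfl]; simp [hx]
  have hav : avg d x y = (d : K)⁻¹ • ∑ s ∈ Finset.range d, v ^ s := by
    unfold avg
    congr 1
    exact Finset.sum_congr rfl fun s hs => hvs s (Finset.mem_range.1 hs).le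
  have hvS : v * ∑ s ∈ Finset.range d, v ^ s = ∑ s ∈ Finset.range d, v ^ s := by
    have h1 := Finset.sum_range_succ (fun s => v ^ s) d
    have h2 := Finset.sum_range_succ' (fun s => v ^ s) d
    rw [h1, hvd, pow_zero] at h2
    rw [Finset.mul_sum]
    simp only [← pow_succ']
    exact (add_right_cancel h2).symm
  have hpS : ∀ s, v ^ s * ∑ s ∈ Finset.range d, v ^ s = ∑ s ∈ Finset.range d, v ^ s := by
    intro s
    induction s with
    | zero => simp
    | succ s ih => rw [pow_succ, mul_assoc, hvS, ih]
  have hSS : (∑ s ∈ Finset.range d, v ^ s) * ∑ s ∈ Finset.range d, v ^ s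
      = (d : K) • ∑ s ∈ Finset.range d, v ^ s := by
    rw [Finset.sum_mul, Finset.sum_congr rfl fun s _ => hpS s]
    simp [Nat.cast_smul_eq_nsmul]
  have hd0 : (d : K) ≠ 0 := by exact_mod_cast hd.ne'
  rw [hav, smul_mul_smul_comm, hSS, smul_smul, mul_assoc, inv_mul_cancel₀ hd0, mul_one]

theorem YH.e_mul_self (d : ℕ) {n : ℕ} (i : Fin (n - 1)) : YH.e d i * YH.e d i = YH.e d i := by
  have hp : ∀ j : Fin n, YH.t d j ^ d = 1 := by
    intro j
    have := RingQuot.mkAlgHom_rel K (YHRel.t_pow (d := d) j)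
    rwa [map_pow, map_one] at this
  apply avg_mul_self _ _ _ _ (hp _) (hp _)
  have := RingQuot.mkAlgHom_rel K (YHRel.tt (d := d) (lo i) (hi i))
  rwa [map_mul, map_mul] at this

theorem YH.g_sq (d : ℕ) {n : ℕ} (i : Fin (n - 1)) :
    YH.g d i * YH.g d i = 1 + (q - q⁻¹) • (YH.e d i * YH.g d i) := by
  have := RingQuot.mkAlgHom_rel K (YHRel.quadratic (d := d) i)
  simpa [pow_two, avg, YH.e, YH.g, YH.t] using this

theorem YH.g_mem (d : ℕ) {n : ℕ} (i : Fin (n - 1)) : YH.g d i ∈ YHbr d n :=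
  Algebra.subset_adjoin ⟨i, rfl⟩

theorem YH.e_mem (d : ℕ) {n : ℕ} (i : Fin (n - 1)) : YH.e d i ∈ YHbr d n := by
  have hg := YH.g_mem d i
  have h1 : YH.e d i * YH.g d i ∈ YHbr d n := by
    have : YH.e d i * YH.g d i = (q - q⁻¹)⁻¹ • (YH.g d i * YH.g d i - 1) := by
      rw [YH.g_sq, add_sub_cancel_left, smul_smul, inv_mul_cancel₀ q_sub_inv_ne_zero, one_smul]
    rw [this]
    exact Subalgebra.smul_mem _ (Subalgebra.sub_mem _ (Subalgebra.mul_mem _ hg hg)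
      (Subalgebra.one_mem _)) _
  have h2 : YH.e d i
      = YH.e d i * YH.g d i * YH.g d i - (q - q⁻¹) • (YH.e d i * YH.g d i) := by
    rw [mul_assoc, YH.g_sq, mul_add, mul_one, mul_smul_comm, ← mul_assoc, YH.e_mul_self,
      add_sub_cancel_right]
  rw [h2]
  exact Subalgebra.sub_mem _ (Subalgebra.mul_mem _ h1 hg) (Subalgebra.smul_mem _ h1 _)

namespace YHbr

/-- `g_i` as an element of `Y^{(br)}_{d,n}(q)`. -/
noncomputable def g (d : ℕ) {n : ℕ} (i : Fin (n - 1)) : YHbr d n := ⟨YH.g d i, YH.g_mem d i⟩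

/-- `e_i` as an element of `Y^{(br)}_{d,n}(q)`. -/
noncomputable def e (d : ℕ) {n : ℕ} (i : Fin (n - 1)) : YHbr d n := ⟨YH.e d i, YH.e_mem d i⟩

/-- `e₁ e₂ g_{1,2}` as an element of `Y^{(br)}_{d,n}(q)`. -/
noncomputable def tl (d : ℕ) {n : ℕ} (hn : 3 ≤ n) : YHbr d n :=
  tlElement (e d (idx₁ hn)) (e d (idx₂ hn)) (g d (idx₁ hn)) (g d (idx₂ hn))

end YHbr

/-! ### The framization of the Temperley–Lieb algebra -/

/-- `FTL_{d,n}(q) = Y_{d,n}(q) / ⟨e₁ e₂ g_{1,2}⟩`. -/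
abbrev FTL (d : ℕ) {n : ℕ} (hn : 3 ≤ n) : Type := PrincipalQuotient (YH.tl d hn)

/-- `FTL^{(br)}_{d,n}(q)` as a quotient: `Y^{(br)}_{d,n}(q)` modulo the two-sided ideal of
`Y^{(br)}_{d,n}(q)` generated by `e₁ e₂ g_{1,2}`. -/
abbrev FTLbrQuot (d : ℕ) {n : ℕ} (hn : 3 ≤ n) : Type := PrincipalQuotient (YHbr.tl d hn)

/-- `FTL^{(br)}_{d,n}(q)` as a subalgebra: the subalgebra of `FTL_{d,n}(q)` generated by the
braiding generators, i.e. by the images of the `g_i`. -/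
noncomputable def FTLbr (d : ℕ) {n : ℕ} (hn : 3 ≤ n) : Subalgebra K (FTL d hn) :=
  Algebra.adjoin K (Set.range fun i : Fin (n - 1) => proj (YH.tl d hn) (YH.g d i))

end BraidsTies

/-!
All maps are determined by `b_i ↦ g_i`, `ε_i ↦ e_i`. This assignment respects the relations of the
algebra of braids and ties (`toYH`) and has image `Y^{(br)}_{d,n}(q)` (`toYH_range`), so it induces
surjections `PTL_n(q) → Y^{(br)}_{d,n}(q) / ⟨e₁ e₂ g_{1,2}⟩ → p(Y^{(br)}_{d,n}(q))`. Everything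
therefore reduces to one statement: the composite `PTL_n(q) → FTL_{d,n}(q)` is injective
(`quotToFTL_comp_injective`). It gives the isomorphism `Ψ` directly, and `Φ` because `Φ` is then
injective too.

Injectivity is proved without bases, by a representation of `FTL_{d,n}(q)` in which `PTL_n(q)` acts
faithfully. Conjugation by the `b_i` permutes idempotents `ε_{i,j}` of `E_n(q)` attached to pairs of
strands (`BT.bConj_smul_tie`); these commute, and `ε_{i,j} ε_{j,k} = ε_{j,k} ε_{i,k}`. So they give
a decomposition of `1` into idempotents indexed by the equivalence relations on the strands. Let
`1_χ` be the idempotent of the relation "same colour" for a colouring `χ` of the strands by `d`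
colours; since `d ≥ n`, all equivalence relations occur. For an algebra `A` over `E_n(q)`, consider
the families `f` indexed by the colourings with `f χ ∈ 1_χ A`, and let `t_j` multiply `f χ` by
`ζ ^ χ(j)`, where `ζ` is a primitive `d`-th root of unity, and let `g_i` send `f` to
`χ ↦ b_i f (χ ∘ s_i)`. Then `e_i` becomes the projection to the colourings with
`χ(i) = χ(i + 1)`, on whose members `ε_i` acts as `1`, while `ε_i` kills the other members; hence
the quadratic relation holds and this is a representation of `Y_{d,n}(q)` (`colouredRep`). If
`ε₁ ε₂ b_{1,2}` vanishes in `A`, then `e₁ e₂ g_{1,2}` acts as zero (`colouredRep_tl`). Finally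
`x ↦ (1_χ x)_χ` is an injective `E_n(q)`-linear map from `A` to the representation
(`spread_injective`, `colouredRep_toYH_spread`); for `A = PTL_n(q)` it shows that an element of
`PTL_n(q)` acting as zero is zero.
-/

namespace BraidsTies

/-! ### Averages of commuting roots of unity -/

section avg

variable {A : Type} [Ring A] [Algebra K A] {d : ℕ} {x y z w : A}

/-- Reversal of the order of summation; the terms `s = 0` and `s = d` are both `1`. -/
theorem avg_comm (hxy : Commute x y) (hx : x ^ d = 1) (hy : y ^ d = 1) :
    avg d x y = avg d y x := by
  unfold avg
  congr 1
  have h1 := Finset.sum_range_succ (fun s => x ^ s * y ^ (d - s)) d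
  have h2 := Finset.sum_range_succ' (fun s => x ^ s * y ^ (d - s)) d
  have h3 := Finset.sum_range_reflect (fun s => x ^ (s + 1) * y ^ (d - (s + 1))) d
  have h4 : ∑ s ∈ Finset.range d, x ^ s * y ^ (d - s)
      = ∑ s ∈ Finset.range d, x ^ (s + 1) * y ^ (d - (s + 1)) := by
    apply add_right_cancel (b := (1 : A))
    simpa [hx, hy] using h1.symm.trans h2
  rw [h4, ← h3]
  refine Finset.sum_congr rfl fun s hs => ?_
  have hs := Finset.mem_range.1 hs
  rw [show d - 1 - s + 1 = d - s by omega, show d - (d - s) = s by omega]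
  exact (hxy.pow_pow _ _).eq

theorem Commute.avg_right (hx : Commute w x) (hy : Commute w y) : Commute w (avg d x y) :=
  (Commute.sum_right _ _ _ fun _ _ => (hx.pow_right _).mul_right (hy.pow_right _)).smul_right _

/-- The average does not distinguish its two arguments. -/
theorem avg_mul_left_eq_avg_mul_right (hxy : Commute x y) (hx : x ^ d = 1) (hy : y ^ d = 1) :
    avg d x y * x = avg d x y * y := by
  have h1 := Finset.sum_range_succ (fun s => x ^ s * y ^ (d - s) * y) d
  have h2 := Finset.sum_range_succ' (fun s => x ^ s * y ^ (d - s) * y) d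
  unfold avg
  rw [smul_mul_assoc, smul_mul_assoc, Finset.sum_mul, Finset.sum_mul]
  congr 1
  have h4 : ∑ s ∈ Finset.range d, x ^ s * y ^ (d - s) * y
      = ∑ s ∈ Finset.range d, x ^ (s + 1) * y ^ (d - (s + 1)) * y := by
    apply add_right_cancel (b := y)
    simpa [hx, hy] using h1.symm.trans h2
  rw [h4]
  refine Finset.sum_congr rfl fun s hs => ?_
  have hs := Finset.mem_range.1 hs
  rw [mul_assoc, ← (hxy.pow_right (d - s)).eq, ← mul_assoc, ← pow_succ, mul_assoc, ← pow_succ,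
    show d - (s + 1) + 1 = d - s by omega]

theorem avg_mul_pow (hxy : Commute x y) (hx : x ^ d = 1) (hy : y ^ d = 1) (s : ℕ) :
    avg d x y * x ^ s = avg d x y * y ^ s := by
  induction s with
  | zero => simp
  | succ s ih =>
    rw [pow_succ, ← mul_assoc, ih, mul_assoc, ← (hxy.pow_right s).eq, ← mul_assoc,
      avg_mul_left_eq_avg_mul_right hxy hx hy, mul_assoc, ← pow_succ']

theorem avg_mul_avg (hxy : Commute x y) (hx : x ^ d = 1) (hy : y ^ d = 1) :
    avg d x y * avg d x z = avg d x y * avg d y z := by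
  have (u : A) : avg d x y * avg d u z
      = (d : K)⁻¹ • ∑ s ∈ Finset.range d, avg d x y * u ^ s * z ^ (d - s) := by
    have h : avg d u z = (d : K)⁻¹ • ∑ s ∈ Finset.range d, u ^ s * z ^ (d - s) := rfl
    rw [h, mul_smul_comm, Finset.mul_sum]
    simp only [mul_assoc]
  simp only [this, avg_mul_pow hxy hx hy]

theorem mul_avg (g : A) {x' y' : A} (hx : g * x = x' * g) (hy : g * y = y' * g) :
    g * avg d x y = avg d x' y' * g := by
  have hp {a a' : A} (h : g * a = a' * g) (s : ℕ) : g * a ^ s = a' ^ s * g :=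
    (SemiconjBy.pow_right h s)
  unfold avg
  rw [mul_smul_comm, smul_mul_assoc, Finset.mul_sum, Finset.sum_mul]
  congr 1
  refine Finset.sum_congr rfl fun s _ => ?_
  rw [← mul_assoc, hp hx, mul_assoc, hp hy, mul_assoc]

theorem map_avg {B : Type} [Ring B] [Algebra K B] (f : A →ₐ[K] B) :
    f (avg d x y) = avg d (f x) (f y) := by
  simp [avg]

theorem map_tlElement {B : Type} [Ring B] [Algebra K B] (f : A →ₐ[K] B) :
    f (tlElement x y z w) = tlElement (f x) (f y) (f z) (f w) := by
  simp [tlElement]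

end avg

/-! ### The homomorphism from the algebra of braids and ties -/

namespace YH

variable {d n : ℕ}

theorem t_pow (j : Fin n) : t d j ^ d = 1 := by
  have := RingQuot.mkAlgHom_rel K (YHRel.t_pow (d := d) j)
  rwa [map_pow, map_one] at this

theorem t_comm (i j : Fin n) : Commute (t d i) (t d j) := by
  have := RingQuot.mkAlgHom_rel K (YHRel.tt (d := d) i j)
  rwa [map_mul, map_mul] at this

theorem g_mul_t (i : Fin (n - 1)) (j : Fin n) :
    g d i * t d j = t d (Equiv.swap (lo i) (hi i) j) * g d i := by
  have := RingQuot.mkAlgHom_rel K (YHRel.gt (d := d) i j)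
  rwa [map_mul, map_mul] at this

theorem g_far (i j : Fin (n - 1)) (h : Far i j) : g d i * g d j = g d j * g d i := by
  have := RingQuot.mkAlgHom_rel K (YHRel.gg_far (d := d) i j h)
  rwa [map_mul, map_mul] at this

theorem g_braid (i j : Fin (n - 1)) (h : Near i j) :
    g d i * g d j * g d i = g d j * g d i * g d j := by
  have := RingQuot.mkAlgHom_rel K (YHRel.braid (d := d) i j h)
  rwa [map_mul, map_mul, map_mul, map_mul] at this

/-- The idempotent `e_{i,j}` attached to two strands. -/
noncomputable def pairE (d : ℕ) {n : ℕ} (i j : Fin n) : YH d n := avg d (t d i) (t d j)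

theorem pairE_comm (i j : Fin n) : pairE d i j = pairE d j i :=
  avg_comm (t_comm i j) (t_pow i) (t_pow j)

theorem pairE_mul_comm (i j k l : Fin n) : pairE d i j * pairE d k l = pairE d k l * pairE d i j :=
  (Commute.avg_right (Commute.avg_right (t_comm k i) (t_comm k j)).symm
    (Commute.avg_right (t_comm l i) (t_comm l j)).symm).eq

theorem pairE_trans (i j k : Fin n) : pairE d i j * pairE d i k = pairE d i j * pairE d j k :=
  avg_mul_avg (t_comm i j) (t_pow i) (t_pow j)

theorem g_mul_pairE (i : Fin (n - 1)) (j k : Fin n) :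
    g d i * pairE d j k
      = pairE d (Equiv.swap (lo i) (hi i) j) (Equiv.swap (lo i) (hi i) k) * g d i :=
  mul_avg _ (g_mul_t i j) (g_mul_t i k)

theorem e_eq_pairE (i : Fin (n - 1)) : e d i = pairE d (lo i) (hi i) := rfl

theorem g_mul_e_self (i : Fin (n - 1)) : g d i * e d i = e d i * g d i := by
  rw [e_eq_pairE, g_mul_pairE, Equiv.swap_apply_left, Equiv.swap_apply_right, pairE_comm]

theorem g_mul_e_far (i j : Fin (n - 1)) (h : Far i j) : g d i * e d j = e d j * g d i := by
  rw [e_eq_pairE, g_mul_pairE, Equiv.swap_apply_of_ne_of_ne, Equiv.swap_apply_of_ne_of_ne] <;>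
  · simp only [ne_eq, lo, hi, Fin.mk.injEq]
    unfold Far at h
    omega

/-- The three strands met by two neighbouring generators: `g_i` exchanges `a` and `b`, and `g_j`
exchanges `b` and `c`. -/
theorem exists_strands {i j : Fin (n - 1)} (h : Near i j) : ∃ a b c : Fin n,
    a ≠ b ∧ a ≠ c ∧ b ≠ c ∧ e d i = pairE d a b ∧ e d j = pairE d b c ∧
      Equiv.swap (lo i) (hi i) = Equiv.swap a b ∧ Equiv.swap (lo j) (hi j) = Equiv.swap b c := by
  rcases h with h | h
  · have hb : hi i = lo j := Fin.ext h
    refine ⟨lo i, hi i, hi j, ?_, ?_, ?_, rfl, ?_, rfl, ?_⟩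
    · simp [lo, hi]
    · simp only [ne_eq, lo, hi, Fin.mk.injEq]; omega
    · simp only [ne_eq, hi, Fin.mk.injEq]; omega
    · rw [hb]; rfl
    · rw [hb]
  · have hb : hi j = lo i := Fin.ext h
    refine ⟨hi i, lo i, lo j, ?_, ?_, ?_, pairE_comm _ _, ?_, Equiv.swap_comm _ _, ?_⟩
    · simp [lo, hi]
    · simp only [ne_eq, lo, hi, Fin.mk.injEq]; omega
    · simp only [ne_eq, lo, Fin.mk.injEq]; omega
    · rw [← hb, pairE_comm]; rfl
    · rw [← hb, Equiv.swap_comm]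

theorem e_mul_e_mul_g (i j : Fin (n - 1)) (h : Near i j) :
    e d i * e d j * g d i = g d i * e d i * e d j := by
  obtain ⟨a, b, c, hab, hac, hbc, hi, hj, si, sj⟩ := exists_strands (d := d) h
  rw [mul_assoc (g d i), hi, hj, ← mul_assoc (g d i), g_mul_pairE, mul_assoc _ (g d i),
    g_mul_pairE, si, Equiv.swap_apply_left, Equiv.swap_apply_right,
    Equiv.swap_apply_of_ne_of_ne hac.symm hbc.symm, ← mul_assoc, ← pairE_trans, pairE_comm b a]

theorem g_mul_e_mul_e (i j : Fin (n - 1)) (h : Near i j) :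
    g d i * e d i * e d j = e d j * g d i * e d j := by
  rw [← e_mul_e_mul_g i j h]
  obtain ⟨a, b, c, hab, hac, hbc, hi, hj, si, sj⟩ := exists_strands (d := d) h
  rw [mul_assoc (e d j), hi, hj, g_mul_pairE, si, Equiv.swap_apply_right,
    Equiv.swap_apply_of_ne_of_ne hac.symm hbc.symm, ← mul_assoc, pairE_mul_comm a b,
    pairE_comm a b, pairE_comm b c, pairE_comm a c, pairE_trans c b a]

theorem e_mul_g_mul_g (i j : Fin (n - 1)) (h : Near i j) :
    e d i * g d j * g d i = g d j * g d i * e d j := by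
  obtain ⟨a, b, c, hab, hac, hbc, hi, hj, si, sj⟩ := exists_strands (d := d) h
  rw [mul_assoc (g d j), hj, g_mul_pairE, si, ← mul_assoc, g_mul_pairE, sj,
    Equiv.swap_apply_right, Equiv.swap_apply_of_ne_of_ne hac.symm hbc.symm,
    Equiv.swap_apply_of_ne_of_ne hab hac, Equiv.swap_apply_right, hi]

end YH

/-- The homomorphism `E_n(q) → Y_{d,n}(q)`, `b_i ↦ g_i`, `ε_i ↦ e_i`. -/
noncomputable def toYH (d n : ℕ) : BT n →ₐ[K] YH d n :=
  RingQuot.liftAlgHom K ⟨FreeAlgebra.lift K fun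
    | BTGen.b i => YH.g d i
    | BTGen.ε i => YH.e d i, by
    intro x y h
    induction h with
    | braid i j h => simpa using YH.g_braid i j (Or.inl h)
    | bb_far i j h => simpa using YH.g_far i j h
    | εε_far i j h => simpa [YH.e_eq_pairE] using YH.pairE_mul_comm _ _ _ _
    | ε_sq i => simpa [pow_two] using YH.e_mul_self d i
    | εb_same i => simpa using (YH.g_mul_e_self i).symm
    | εb_far i j h => simpa using (YH.g_mul_e_far j i h.symm).symm
    | εεb_left i j h => simpa using YH.e_mul_e_mul_g i j h
    | εεb_right i j h => simpa using YH.g_mul_e_mul_e i j h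
    | εbb i j h => simpa using YH.e_mul_g_mul_g i j h
    | quadratic i => simpa [pow_two] using YH.g_sq d i⟩

variable {d n : ℕ}

@[simp]
theorem toYH_b (i : Fin (n - 1)) : toYH d n (BT.b i) = YH.g d i := by
  simp [toYH, BT.b]

@[simp]
theorem toYH_ε (i : Fin (n - 1)) : toYH d n (BT.ε i) = YH.e d i := by
  simp [toYH, BT.ε]

/-- Induction over the generators of the algebra of braids and ties. -/
theorem BT.induction {p : BT n → Prop} (scalar : ∀ r : K, p (algebraMap K _ r))
    (b : ∀ i, p (BT.b i)) (ε : ∀ i, p (BT.ε i)) (add : ∀ x y, p x → p y → p (x + y))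
    (mul : ∀ x y, p x → p y → p (x * y)) (x : BT n) : p x := by
  obtain ⟨x, rfl⟩ := RingQuot.mkAlgHom_surjective K (BTRel n) x
  induction x using FreeAlgebra.induction with
  | grade0 r => simpa using scalar r
  | grade1 i =>
    cases i with
    | b i => exact b i
    | ε i => exact ε i
  | mul x y hx hy => rw [map_mul]; exact mul _ _ hx hy
  | add x y hx hy => rw [map_add]; exact add _ _ hx hy

theorem toYH_range : (toYH d n).range = YHbr d n := by
  apply le_antisymm
  · rintro _ ⟨x, rfl⟩
    change toYH d n x ∈ YHbr d n
    induction x using BT.induction with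
    | scalar r => rw [AlgHom.commutes]; exact Subalgebra.algebraMap_mem _ r
    | b i => rw [toYH_b]; exact YH.g_mem d i
    | ε i => rw [toYH_ε]; exact YH.e_mem d i
    | add x y hx hy => rw [map_add]; exact Subalgebra.add_mem _ hx hy
    | mul x y hx hy => rw [map_mul]; exact Subalgebra.mul_mem _ hx hy
  · refine Algebra.adjoin_le ?_
    rintro _ ⟨i, rfl⟩
    exact ⟨BT.b i, toYH_b i⟩

/-! ### Extending a family from adjacent pairs to all pairs -/

section PairFamily

variable {G X : Type} [Group G] [MulAction G X]

/-- Elements `v_k` satisfying the braid relations of `n` strands and acting on points `x_k`, where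
`x_k` is meant to be attached to the pair `{k, k + 1}`. The conditions are those under which
the action of the braid group on the points generated by the `x_k` permutes pairs of strands. -/
structure AdjacentPairFamily (n : ℕ) (v : ℕ → G) (x : ℕ → X) : Prop where
  far : ∀ k l, k + 1 < l → l + 1 < n → v k * v l = v l * v k
  braid : ∀ k, k + 2 < n → v k * v (k + 1) * v k = v (k + 1) * v k * v (k + 1)
  fix : ∀ k, k + 1 < n → v k • x k = x k
  fix_right : ∀ k l, k + 1 < l → l + 1 < n → v k • x l = x l
  fix_left : ∀ k l, k + 1 < l → l + 1 < n → v l • x k = x k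
  sq_right : ∀ k, k + 2 < n → v k • v k • x (k + 1) = x (k + 1)
  sq_left : ∀ k, k + 2 < n → v (k + 1) • v (k + 1) • x k = x k
  slide : ∀ k, k + 2 < n → v k • x (k + 1) = v (k + 1) • x k

/-- The point attached to the pair `{i, i + m + 1}`: the point `x_i`, with the right end of the pair
`{i, i + 1}` moved `m` steps. -/
def gapPoint (v : ℕ → G) (x : ℕ → X) (i : ℕ) : ℕ → X
  | 0 => x i
  | m + 1 => v (i + m + 1) • gapPoint v x i m

/-- The point attached to the pair `{i, j}`, `i ≠ j`. -/
def pairPoint (v : ℕ → G) (x : ℕ → X) (i j : ℕ) : X :=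
  gapPoint v x (min i j) (max i j - min i j - 1)

theorem pairPoint_comm (v : ℕ → G) (x : ℕ → X) (i j : ℕ) :
    pairPoint v x i j = pairPoint v x j i := by
  simp only [pairPoint, min_comm, max_comm]

namespace AdjacentPairFamily

variable {n : ℕ} {v : ℕ → G} {x : ℕ → X} (H : AdjacentPairFamily n v x)
include H

theorem smul_far (k l : ℕ) (h : k + 1 < l) (hl : l + 1 < n) (y : X) :
    v k • v l • y = v l • v k • y := by
  rw [smul_smul, smul_smul, H.far k l h hl]

theorem smul_gapPoint_of_lt (k i m : ℕ) (h : k + 1 < i) (hn : i + m + 1 < n) :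
    v k • gapPoint v x i m = gapPoint v x i m := by
  induction m with
  | zero => exact H.fix_right k i h hn
  | succ m ih => rw [gapPoint, H.smul_far _ _ (by omega) (by omega), ih (by omega)]

theorem smul_gapPoint_of_gt (k i m : ℕ) (h : i + m + 1 < k) (hn : k + 1 < n) :
    v k • gapPoint v x i m = gapPoint v x i m := by
  induction m with
  | zero => exact H.fix_left i k h hn
  | succ m ih => rw [gapPoint, ← H.smul_far _ _ (by omega) (by omega), ih (by omega)]

/-- Moving the left end of the pair `{i, i + 1}` to the left gives the same points as moving the right
end to the right. -/
theorem smul_gapPoint_pred (i m : ℕ) (hn : i + m + 2 < n) :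
    v i • gapPoint v x (i + 1) m = gapPoint v x i (m + 1) := by
  induction m with
  | zero => exact H.slide i hn
  | succ m ih =>
    rw [gapPoint, H.smul_far _ _ (by omega) (by omega), ih (by omega), gapPoint.eq_2 _ _ _ (m + 1),
      show i + 1 + m + 1 = i + (m + 1) + 1 by omega]

theorem smul_gapPoint_left (i m : ℕ) (hn : i + m + 2 < n) :
    v i • gapPoint v x i (m + 1) = gapPoint v x (i + 1) m := by
  rw [← H.smul_gapPoint_pred i m hn]
  induction m with
  | zero => exact H.sq_right i hn
  | succ m ih =>
    rw [gapPoint, H.smul_far i (i + 1 + m + 1) (by omega) (by omega),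
      H.smul_far i (i + 1 + m + 1) (by omega) (by omega), ih (by omega)]

theorem smul_gapPoint_right (i m : ℕ) (hn : i + m + 2 < n) :
    v (i + m + 1) • gapPoint v x i (m + 1) = gapPoint v x i m := by
  rw [gapPoint]
  induction m generalizing i with
  | zero => exact H.sq_left i hn
  | succ m ih =>
    have h := ih (i + 1) (by omega)
    rw [show i + 1 + m + 1 = i + (m + 1) + 1 by omega] at h
    rw [← H.smul_gapPoint_pred i m (by omega), ← H.smul_far i _ (by omega) (by omega),
      ← H.smul_far i _ (by omega) (by omega), h]

theorem smul_gapPoint_of_between (k i m : ℕ) (h : i < k) (hm : k < i + m) (hn : i + m + 1 < n) :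
    v k • gapPoint v x i m = gapPoint v x i m := by
  induction m with
  | zero => omega
  | succ m ih =>
    rcases Nat.lt_or_ge k (i + m) with h' | h'
    · rw [gapPoint, H.smul_far _ _ (by omega) (by omega), ih h' (by omega)]
    · obtain ⟨c, rfl⟩ := Nat.exists_eq_add_of_lt h
      obtain rfl : m = c + 1 := by omega
      rw [gapPoint, gapPoint, show i + (c + 1) + 1 = i + c + 1 + 1 by omega, smul_smul, smul_smul,
        H.braid _ (by omega), mul_smul, mul_smul, H.smul_gapPoint_of_gt _ _ _ (by omega) (by omega)]

theorem smul_pairPoint_of_lt (k i j : ℕ) (hk : k + 1 < n) (hij : i < j) (hj : j < n) :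
    v k • pairPoint v x i j
      = pairPoint v x (Equiv.swap k (k + 1) i) (Equiv.swap k (k + 1) j) := by
  obtain ⟨m, rfl⟩ := Nat.exists_eq_add_of_lt hij
  have hp (a c : ℕ) : pairPoint v x a (a + c + 1) = gapPoint v x a c := by
    unfold pairPoint
    rw [min_eq_left (by omega), max_eq_right (by omega), show a + c + 1 - a - 1 = c by omega]
  have hs (l : ℕ) (h1 : l ≠ k) (h2 : l ≠ k + 1) : Equiv.swap k (k + 1) l = l :=
    Equiv.swap_apply_of_ne_of_ne h1 h2
  rw [hp]
  rcases lt_trichotomy (k + 1) i with h | rfl | h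
  · rw [hs _ (by omega) (by omega), hs _ (by omega) (by omega), hp,
      H.smul_gapPoint_of_lt _ _ _ h hj]
  · rw [Equiv.swap_apply_right, hs _ (by omega) (by omega), H.smul_gapPoint_pred _ _ (by omega),
      ← hp, show k + 1 + m + 1 = k + (m + 1) + 1 by omega]
  rcases lt_trichotomy k (i + m + 1) with h' | rfl | h'
  · rcases (show i = k ∨ i < k by omega) with rfl | hik
    · rw [Equiv.swap_apply_left]
      rcases m with _ | m
      · rw [add_zero, Equiv.swap_apply_right, pairPoint_comm]
        exact (H.fix i hk).trans (hp i 0).symm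
      · rw [H.smul_gapPoint_left _ _ (by omega), hs _ (by omega) (by omega), ← hp,
          show i + (m + 1) + 1 = i + 1 + m + 1 by omega]
    · rw [hs i (by omega) (by omega)]
      rcases (show k = i + m ∨ k < i + m by omega) with rfl | hk'
      · obtain ⟨m, rfl⟩ : ∃ c, m = c + 1 := ⟨m - 1, by omega⟩
        rw [Equiv.swap_apply_right, ← add_assoc, hp, H.smul_gapPoint_right _ _ (by omega)]
      · rw [hs _ (by omega) (by omega), hp, H.smul_gapPoint_of_between _ _ _ hik hk' hj]
  · rw [Equiv.swap_apply_left, hs i (by omega) (by omega),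
      show i + m + 1 + 1 = i + (m + 1) + 1 by omega, hp]
    rfl
  · rw [hs _ (by omega) (by omega), hs _ (by omega) (by omega), hp,
      H.smul_gapPoint_of_gt _ _ _ h' hk]

theorem smul_pairPoint (k i j : ℕ) (hk : k + 1 < n) (hij : i ≠ j) (hi : i < n) (hj : j < n) :
    v k • pairPoint v x i j
      = pairPoint v x (Equiv.swap k (k + 1) i) (Equiv.swap k (k + 1) j) := by
  rcases hij.lt_or_gt with h | h
  · exact H.smul_pairPoint_of_lt k i j hk h hj
  · rw [pairPoint_comm, H.smul_pairPoint_of_lt k j i hk h hi, pairPoint_comm]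

end AdjacentPairFamily

end PairFamily

/-! ### Conjugation by the braid generators in the algebra of braids and ties -/

theorem Near.symm {m : ℕ} {i j : Fin m} (h : Near i j) : Near j i := Or.symm h

namespace BT

variable {n : ℕ}

theorem b_braid (i j : Fin (n - 1)) (h : (i : ℕ) + 1 = j) : b i * b j * b i = b j * b i * b j := by
  have := RingQuot.mkAlgHom_rel K (BTRel.braid i j h)
  rwa [map_mul, map_mul, map_mul, map_mul] at this

theorem b_far (i j : Fin (n - 1)) (h : Far i j) : b i * b j = b j * b i := by
  have := RingQuot.mkAlgHom_rel K (BTRel.bb_far i j h)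
  rwa [map_mul, map_mul] at this

theorem ε_far (i j : Fin (n - 1)) (h : Far i j) : ε i * ε j = ε j * ε i := by
  have := RingQuot.mkAlgHom_rel K (BTRel.εε_far i j h)
  rwa [map_mul, map_mul] at this

theorem ε_mul_self (i : Fin (n - 1)) : ε i * ε i = ε i := by
  have := RingQuot.mkAlgHom_rel K (BTRel.ε_sq i)
  rwa [map_pow, pow_two] at this

theorem ε_mul_b_self (i : Fin (n - 1)) : ε i * b i = b i * ε i := by
  have := RingQuot.mkAlgHom_rel K (BTRel.εb_same i)
  rwa [map_mul, map_mul] at this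

theorem ε_mul_b_far (i j : Fin (n - 1)) (h : Far i j) : ε i * b j = b j * ε i := by
  have := RingQuot.mkAlgHom_rel K (BTRel.εb_far i j h)
  rwa [map_mul, map_mul] at this

theorem ε_mul_ε_mul_b (i j : Fin (n - 1)) (h : Near i j) : ε i * ε j * b i = b i * ε i * ε j := by
  have := RingQuot.mkAlgHom_rel K (BTRel.εεb_left i j h)
  rwa [map_mul, map_mul, map_mul, map_mul] at this

theorem b_mul_ε_mul_ε (i j : Fin (n - 1)) (h : Near i j) : b i * ε i * ε j = ε j * b i * ε j := by
  have := RingQuot.mkAlgHom_rel K (BTRel.εεb_right i j h)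
  rwa [map_mul, map_mul, map_mul, map_mul] at this

theorem ε_mul_b_mul_b (i j : Fin (n - 1)) (h : Near i j) : ε i * b j * b i = b j * b i * ε j := by
  have := RingQuot.mkAlgHom_rel K (BTRel.εbb i j h)
  rwa [map_mul, map_mul, map_mul, map_mul] at this

theorem b_sq (i : Fin (n - 1)) : b i * b i = 1 + (q - q⁻¹) • (ε i * b i) := by
  have := RingQuot.mkAlgHom_rel K (BTRel.quadratic i)
  rwa [map_pow, pow_two, map_add, map_one, map_smul, map_mul] at this

/-- `b_i` as a unit, with inverse `b_i - (q - q⁻¹) ε_i`. -/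
noncomputable def bUnit (i : Fin (n - 1)) : (BT n)ˣ where
  val := b i
  inv := b i - (q - q⁻¹) • ε i
  val_inv := by rw [mul_sub, b_sq, mul_smul_comm, ε_mul_b_self, add_sub_cancel_right]
  inv_val := by rw [sub_mul, b_sq, smul_mul_assoc, add_sub_cancel_right]

@[simp]
theorem val_bUnit (i : Fin (n - 1)) : (bUnit i : BT n) = b i := rfl

/-- Conjugation by `b_i`. -/
noncomputable def bConj (i : Fin (n - 1)) : ConjAct (BT n)ˣ := ConjAct.toConjAct (bUnit i)

theorem bConj_smul_eq_iff (i : Fin (n - 1)) (x y : BT n) :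
    bConj i • x = y ↔ b i * x = y * b i := by
  rw [bConj, ConjAct.units_smul_def, ConjAct.ofConjAct_toConjAct, Units.mul_inv_eq_iff_eq_mul,
    val_bUnit]

theorem bConj_smul_mul_b (i : Fin (n - 1)) (x : BT n) : bConj i • x * b i = b i * x :=
  ((bConj_smul_eq_iff i x _).1 rfl).symm

/-- Both `b_i` and its inverse commute with `ε_i ε_j`, hence so does `ε_i`. -/
theorem ε_comm_of_near (i j : Fin (n - 1)) (h : Near i j) : ε i * ε j = ε j * ε i := by
  have hb : Commute (bUnit i : BT n) (ε i * ε j) := by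
    have := (ε_mul_ε_mul_b i j h).symm
    rwa [mul_assoc] at this
  have hd : (q - q⁻¹) • ε i = (bUnit i : BT n) - ↑(bUnit i)⁻¹ := by
    change _ = b i - (b i - (q - q⁻¹) • ε i)
    rw [sub_sub_cancel]
  have hc : Commute (ε i) (ε i * ε j) := by
    have h1 : Commute ((q - q⁻¹) • ε i) (ε i * ε j) := by
      rw [hd]
      exact hb.sub_left hb.units_inv_left
    have h2 := h1.smul_left (q - q⁻¹)⁻¹
    rwa [smul_smul, inv_mul_cancel₀ q_sub_inv_ne_zero, one_smul] at h2
  have h3 : ε i * (ε j * ε i) = ε j * ε i := by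
    -- After multiplication by `b_j` on the right both sides are `ε_i b_j ε_i`.
    rw [← Units.mul_left_inj (bUnit j), val_bUnit, mul_assoc (ε i), ε_mul_ε_mul_b j i h.symm,
      b_mul_ε_mul_ε j i h.symm, ← mul_assoc, ← mul_assoc, ε_mul_self]
  calc ε i * ε j = ε i * (ε i * ε j) := by rw [← mul_assoc, ε_mul_self]
    _ = ε j * ε i := by rw [hc.eq, mul_assoc, h3]

theorem bConj_smul_ε_self (i : Fin (n - 1)) : bConj i • ε i = ε i :=
  (bConj_smul_eq_iff _ _ _).2 (ε_mul_b_self i).symm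

theorem bConj_smul_ε_far (i j : Fin (n - 1)) (h : Far i j) : bConj i • ε j = ε j :=
  (bConj_smul_eq_iff _ _ _).2 (ε_mul_b_far j i (Or.symm h)).symm

/-- `b_i²` commutes with `ε_j`, because `ε_i ε_j = ε_j ε_i` and this product commutes with `b_i`. -/
theorem bConj_smul_bConj_smul_ε (i j : Fin (n - 1)) (h : Near i j) :
    bConj i • bConj i • ε j = ε j := by
  rw [bConj_smul_eq_iff, ← Units.mul_left_inj (bUnit i), val_bUnit, mul_assoc (b i),
    bConj_smul_mul_b, ← mul_assoc, mul_assoc (ε j), b_sq, add_mul, mul_add, one_mul, mul_one,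
    smul_mul_assoc, mul_smul_comm, ← mul_assoc (ε j), ← ε_comm_of_near i j h, ε_mul_ε_mul_b i j h,
    ε_mul_b_self]

/-- Since `b_j b_i ε_j = ε_i b_j b_i` and `b_j²` commutes with `ε_i`, both conjugates give the
idempotent tying the two outer strands of three adjacent ones. -/
theorem bConj_smul_slide (i j : Fin (n - 1)) (h : Near i j) : bConj i • ε j = bConj j • ε i := by
  have h1 : bConj j • bConj i • ε j = ε i := by
    rw [bConj_smul_eq_iff, ← Units.mul_left_inj (bUnit i), val_bUnit, mul_assoc,
      bConj_smul_mul_b, ← mul_assoc, ε_mul_b_mul_b i j h]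
  rw [← smul_left_cancel_iff (bConj j), h1, bConj_smul_bConj_smul_ε j i h.symm]

/-- The conjugations by the `b_k`, indexed by natural numbers; `1` out of range. -/
noncomputable def natConj (n k : ℕ) : ConjAct (BT n)ˣ := if h : k < n - 1 then bConj ⟨k, h⟩ else 1

/-- The generators `ε_k`, indexed by natural numbers; `1` out of range. -/
noncomputable def natε (n k : ℕ) : BT n := if h : k < n - 1 then ε ⟨k, h⟩ else 1

theorem natConj_eq (k : ℕ) (h : k < n - 1) : natConj n k = bConj ⟨k, h⟩ := dif_pos h

theorem natε_eq (k : ℕ) (h : k < n - 1) : natε n k = ε ⟨k, h⟩ := dif_pos h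

theorem adjacentPairFamily (n : ℕ) : AdjacentPairFamily n (natConj n) (natε n) where
  far k l h hl := by
    rw [natConj_eq k (by omega), natConj_eq l (by omega)]
    simp only [bConj, ← ConjAct.toConjAct_mul]
    congr 1
    exact Units.ext (b_far _ _ (Or.inl h))
  braid k h := by
    rw [natConj_eq k (by omega), natConj_eq (k + 1) (by omega)]
    simp only [bConj, ← ConjAct.toConjAct_mul]
    congr 1
    exact Units.ext (b_braid _ _ rfl)
  fix k h := by
    rw [natConj_eq k (by omega), natε_eq k (by omega), bConj_smul_ε_self]
  fix_right k l h hl := by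
    rw [natConj_eq k (by omega), natε_eq l (by omega), bConj_smul_ε_far _ _ (Or.inl h)]
  fix_left k l h hl := by
    rw [natConj_eq l (by omega), natε_eq k (by omega), bConj_smul_ε_far _ _ (Or.inr h)]
  sq_right k h := by
    rw [natConj_eq k (by omega), natε_eq (k + 1) (by omega),
      bConj_smul_bConj_smul_ε _ _ (Or.inl rfl)]
  sq_left k h := by
    rw [natConj_eq (k + 1) (by omega), natε_eq k (by omega),
      bConj_smul_bConj_smul_ε _ _ (Or.inr rfl)]
  slide k h := by
    rw [natConj_eq k (by omega), natConj_eq (k + 1) (by omega), natε_eq k (by omega),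
      natε_eq (k + 1) (by omega), bConj_smul_slide _ _ (Or.inl rfl)]

/-! ### The ties between arbitrary strands -/

/-- The idempotent `ε_{i,j}` tying two strands, a conjugate of the generators; `ε_{i,i} = 1`. -/
noncomputable def tie (i j : Fin n) : BT n :=
  if i = j then 1 else pairPoint (natConj n) (natε n) i j

@[simp]
theorem tie_self (i : Fin n) : tie i i = 1 := if_pos rfl

theorem tie_symm (i j : Fin n) : tie i j = tie j i := by
  simp only [tie, eq_comm (a := i), pairPoint_comm _ _ (i : ℕ)]

theorem tie_lo_hi (i : Fin (n - 1)) : tie (lo i) (hi i) = ε i := by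
  have h : lo i ≠ hi i := by simp [lo, hi]
  rw [tie, if_neg h, pairPoint]
  simp [lo, hi, gapPoint, natε_eq]

theorem bConj_smul_tie (k : Fin (n - 1)) (i j : Fin n) :
    bConj k • tie i j = tie (Equiv.swap (lo k) (hi k) i) (Equiv.swap (lo k) (hi k) j) := by
  by_cases hij : i = j
  · subst hij; rw [tie_self, tie_self, smul_one]
  have hs (l : Fin n) : ((Equiv.swap (lo k) (hi k) l : Fin n) : ℕ)
      = Equiv.swap (k : ℕ) (k + 1) l := by
    simp only [Equiv.swap_apply_def, lo, hi, Fin.ext_iff]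
    split_ifs <;> rfl
  have := (adjacentPairFamily n).smul_pairPoint k i j (by omega) (Fin.val_ne_of_ne hij) i.2 j.2
  rw [natConj_eq k k.2, ← hs, ← hs] at this
  rw [tie, if_neg hij, tie, if_neg (by simpa using hij), ← this]

/-- All permutations of the strands are induced by conjugations. -/
theorem exists_conj_smul_tie (σ : Equiv.Perm (Fin n)) :
    ∃ u : ConjAct (BT n)ˣ, ∀ i j, u • tie i j = tie (σ i) (σ j) := by
  obtain _ | n := n
  · exact ⟨1, fun i => i.elim0⟩
  have hσ : σ ∈ Submonoid.closure
      (Set.range fun i : Fin n => Equiv.swap i.castSucc i.succ) := by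
    rw [Equiv.Perm.mclosure_swap_castSucc_succ]; trivial
  induction hσ using Submonoid.closure_induction with
  | mem σ h =>
    obtain ⟨k, rfl⟩ := h
    exact ⟨bConj (n := n + 1) k, fun i j => bConj_smul_tie (n := n + 1) k i j⟩
  | one => exact ⟨1, fun i j => one_smul _ _⟩
  | mul σ τ _ _ hσ hτ =>
    obtain ⟨u, hu⟩ := hσ
    obtain ⟨v, hv⟩ := hτ
    exact ⟨u * v, fun i j => by rw [mul_smul, hv, hu]; rfl⟩

theorem exists_conj_of_injective {m : ℕ} (h : m ≤ n) (f : Fin m → Fin n)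
    (hf : Function.Injective f) : ∃ u : ConjAct (BT n)ˣ, ∀ i j : Fin m,
      u • tie (Fin.castLE h i) (Fin.castLE h j) = tie (f i) (f j) := by
  have := Equiv.Perm.isMultiplyPretransitive (Fin n) m
  obtain ⟨σ, hσ⟩ := MulAction.exists_smul_eq (Equiv.Perm (Fin n)) (Fin.castLEEmb h) ⟨f, hf⟩
  obtain ⟨u, hu⟩ := exists_conj_smul_tie σ
  have hσ' (i : Fin m) : σ (Fin.castLE h i) = f i := DFunLike.congr_fun hσ i
  exact ⟨u, fun i j => by rw [hu, hσ', hσ']⟩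

theorem tie_mul_self (i j : Fin n) : tie i j * tie i j = tie i j := by
  by_cases hij : i = j
  · rw [hij, tie_self, one_mul]
  have hn : 2 ≤ n := by omega
  obtain ⟨u, hu⟩ := exists_conj_of_injective hn ![i, j] (by
    intro a b; fin_cases a <;> fin_cases b <;> simp [hij, Ne.symm hij])
  have h : tie (Fin.castLE hn 0) (Fin.castLE hn 1) = ε ⟨0, by omega⟩ :=
    tie_lo_hi (n := n) ⟨0, by omega⟩
  have := hu 0 1
  simp only [Matrix.cons_val_zero, Matrix.cons_val_one] at this
  rw [← this, ← smul_mul', h, ε_mul_self]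

/-- On three distinct strands the relations between the ties are conjugate to those between
`ε₁`, `ε₂` and `b₁ ε₂ b₁⁻¹`. -/
theorem tie_rel_of_ne {i j k : Fin n} (hij : i ≠ j) (hik : i ≠ k) (hjk : j ≠ k) :
    tie i j * tie j k = tie j k * tie i j ∧ tie i j * tie j k = tie j k * tie i k := by
  have hn : 3 ≤ n := by omega
  obtain ⟨u, hu⟩ := exists_conj_of_injective hn ![i, j, k] (by
    intro a b; fin_cases a <;> fin_cases b <;>
      simp [hij, Ne.symm hij, hik, Ne.symm hik, hjk, Ne.symm hjk])
  have h1 : tie (Fin.castLE hn 0) (Fin.castLE hn 1) = ε (idx₁ hn) :=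
    tie_lo_hi (n := n) (idx₁ hn)
  have h2 : tie (Fin.castLE hn 1) (Fin.castLE hn 2) = ε (idx₂ hn) :=
    tie_lo_hi (n := n) (idx₂ hn)
  have h3 : tie (Fin.castLE hn 0) (Fin.castLE hn 2) = bConj (idx₁ hn) • ε (idx₂ hn) := by
    rw [← h2, bConj_smul_tie]
    rfl
  have hnear : Near (idx₁ hn) (idx₂ hn) := Or.inl rfl
  have u1 := hu 0 1
  have u2 := hu 1 2
  have u3 := hu 0 2
  rw [h1] at u1
  rw [h2] at u2
  rw [h3] at u3
  change u • _ = tie i j at u1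
  change u • _ = tie j k at u2
  change u • _ = tie i k at u3
  rw [← u1, ← u2, ← u3, ← smul_mul', ← smul_mul', ← smul_mul']
  refine ⟨by rw [ε_comm_of_near _ _ hnear], ?_⟩
  congr 1
  rw [← Units.mul_left_inj (bUnit (idx₁ hn)), val_bUnit, mul_assoc (ε (idx₂ hn)), bConj_smul_mul_b,
    ε_mul_ε_mul_b _ _ hnear, b_mul_ε_mul_ε _ _ hnear, mul_assoc]

theorem tie_comm (i j k l : Fin n) : Commute (tie i j) (tie k l) := by
  by_cases hij : i = j
  · rw [hij, tie_self]; exact Commute.one_left _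
  by_cases hkl : k = l
  · rw [hkl, tie_self]; exact Commute.one_right _
  have three {i j l : Fin n} (hij : i ≠ j) (hjl : j ≠ l) : Commute (tie i j) (tie j l) := by
    by_cases hil : i = l
    · rw [hil, tie_symm]
    · exact (tie_rel_of_ne hij hil hjl).1
  by_cases hjk : j = k
  · subst hjk; exact three hij hkl
  by_cases hjl : j = l
  · subst hjl; rw [tie_symm k]; exact three hij (Ne.symm hkl)
  by_cases hik : i = k
  · subst hik; rw [tie_symm i j]; exact three (Ne.symm hij) hkl
  by_cases hil : i = l
  · subst hil; rw [tie_symm i j, tie_symm k]; exact three (Ne.symm hij) (Ne.symm hkl)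
  have hinj : Function.Injective ![i, j, k, l] := by
    intro a b; fin_cases a <;> fin_cases b <;>
      simp [hij, Ne.symm hij, hkl, Ne.symm hkl, hjk, Ne.symm hjk, hjl, Ne.symm hjl, hik,
        Ne.symm hik, hil, Ne.symm hil]
  have hn : 4 ≤ n := by
    simpa using Fintype.card_le_of_injective _ hinj
  obtain ⟨u, hu⟩ := exists_conj_of_injective hn ![i, j, k, l] hinj
  have h1 : tie (Fin.castLE hn 0) (Fin.castLE hn 1) = ε ⟨0, by omega⟩ :=
    tie_lo_hi (n := n) ⟨0, by omega⟩
  have h2 : tie (Fin.castLE hn 2) (Fin.castLE hn 3) = ε ⟨2, by omega⟩ :=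
    tie_lo_hi (n := n) ⟨2, by omega⟩
  have u1 := hu 0 1
  have u2 := hu 2 3
  rw [h1] at u1
  rw [h2] at u2
  change u • _ = tie i j at u1
  change u • _ = tie k l at u2
  rw [← u1, ← u2]
  change _ * _ = _ * _
  rw [← smul_mul', ← smul_mul', ε_far]
  exact Or.inl (by simp)

/-- Tying `i`, `j` and `j`, `k` also ties `i` and `k`. -/
theorem tie_trans (i j k : Fin n) : tie i j * tie j k = tie j k * tie i k := by
  by_cases hij : i = j
  · rw [hij, tie_self, one_mul, tie_mul_self]
  by_cases hjk : j = k
  · rw [hjk, tie_self, one_mul, mul_one]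
  by_cases hik : i = k
  · rw [hik, tie_self, mul_one, tie_symm j k, tie_mul_self]
  exact (tie_rel_of_ne hij hik hjk).2

/-! ### The idempotents of set partitions -/

variable {d : ℕ}

/-- The commutative subalgebra of `E_n(q)` generated by the ties. -/
noncomputable abbrev TieAlg (n : ℕ) : Subalgebra K (BT n) :=
  Algebra.adjoin K (Set.range fun p : Fin n × Fin n => tie p.1 p.2)

instance : IsMulCommutative (TieAlg n) :=
  Algebra.isMulCommutative_adjoin K (by
    rintro _ ⟨p, rfl⟩ _ ⟨p', rfl⟩
    exact tie_comm _ _ _ _)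

noncomputable instance : CommRing (TieAlg n) where
  mul_comm := mul_comm'

/-- A tie as an element of the commutative algebra `TieAlg n`. -/
noncomputable def tieElt (p : Fin n × Fin n) : TieAlg n :=
  ⟨tie p.1 p.2, Algebra.subset_adjoin ⟨p, rfl⟩⟩

theorem tieElt_mul_self (p : Fin n × Fin n) : tieElt p * tieElt p = tieElt p :=
  Subtype.ext (tie_mul_self _ _)

/-- The product of the ties of the pairs in `r` and of the complements of the other ties. -/
noncomputable def atom (r : Fin n × Fin n → Bool) : TieAlg n :=
  ∏ p, if r p then tieElt p else 1 - tieElt p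

theorem atom_mul_self (r : Fin n × Fin n → Bool) : atom r * atom r = atom r := by
  rw [atom, ← Finset.prod_mul_distrib]
  refine Finset.prod_congr rfl fun p _ => ?_
  split_ifs
  · exact tieElt_mul_self p
  · rw [mul_sub, sub_mul, sub_mul, tieElt_mul_self]; ring

theorem tieElt_mul_atom (r : Fin n × Fin n → Bool) (p : Fin n × Fin n) :
    tieElt p * atom r = if r p then atom r else 0 := by
  obtain ⟨c, hc⟩ := Finset.dvd_prod_of_mem
    (fun p => if r p then tieElt p else 1 - tieElt p) (Finset.mem_univ p)
  rw [atom, hc, ← mul_assoc]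
  split_ifs
  · rw [tieElt_mul_self]
  · rw [mul_sub, mul_one, tieElt_mul_self, sub_self, zero_mul]

/-- Expansion of `∏ (ε + (1 - ε)) = 1` over all ties `ε`. -/
theorem sum_atom : ∑ r : Fin n × Fin n → Bool, atom r = 1 := by
  have h := Fintype.prod_sum (fun (p : Fin n × Fin n) (c : Bool) =>
    if c then tieElt p else 1 - tieElt p)
  simpa [atom] using h.symm

/-- The relation `i ~ j` if `χ i = χ j`. -/
def sameColour (χ : Fin n → Fin d) : Fin n × Fin n → Bool := fun p => χ p.1 = χ p.2

/-- Only equivalence relations contribute to the decomposition of `1`, and with at least `n`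
colours every equivalence relation on the strands comes from a colouring. -/
theorem exists_sameColour_of_atom_ne_zero (hd : n ≤ d) (r : Fin n × Fin n → Bool)
    (hr : atom r ≠ 0) : ∃ χ : Fin n → Fin d, sameColour χ = r := by
  have key (p : Fin n × Fin n) (h : r p = false) : tieElt p * atom r = 0 := by
    rw [tieElt_mul_atom, h]; rfl
  have key' (p : Fin n × Fin n) (h : r p = true) : tieElt p * atom r = atom r := by
    rw [tieElt_mul_atom, if_pos h]
  have hrefl (i : Fin n) : r (i, i) = true := by
    by_contra h
    have h1 := key (i, i) (by simpa using h)
    rw [show tieElt (i, i) = 1 from Subtype.ext (tie_self i), one_mul] at h1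
    exact hr h1
  have hsymm (i j : Fin n) (h : r (i, j) = true) : r (j, i) = true := by
    by_contra h'
    have h1 := key (j, i) (by simpa using h')
    rw [show tieElt (j, i) = tieElt (i, j) from Subtype.ext (tie_symm j i), key' _ h] at h1
    exact hr h1
  have htrans (i j k : Fin n) (h : r (i, j) = true) (h' : r (j, k) = true) : r (i, k) = true := by
    by_contra h''
    have h1 := key (i, k) (by simpa using h'')
    apply hr
    have h2 : tieElt (i, j) * tieElt (j, k) = tieElt (j, k) * tieElt (i, k) :=
      Subtype.ext (tie_trans i j k)
    rw [← key' _ h, ← key' _ h', ← mul_assoc, h2, mul_assoc, h1, mul_zero]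
  let s : Setoid (Fin n) :=
    ⟨fun i j => r (i, j) = true, ⟨hrefl, fun {i j} => hsymm i j, fun {i j k} => htrans i j k⟩⟩
  have hcard : Nat.card (Quotient s) ≤ Nat.card (Fin d) := by
    rw [Nat.card_fin]
    exact (Nat.card_le_card_of_surjective _ Quotient.mk_surjective).trans (by simpa using hd)
  obtain ⟨f⟩ : Nonempty (Quotient s ↪ Fin d) := by
    have := Fintype.ofFinite (Quotient s)
    refine Function.Embedding.nonempty_of_card_le ?_
    rwa [Nat.card_eq_fintype_card, Nat.card_eq_fintype_card] at hcard
  refine ⟨fun i => f (Quotient.mk s i), funext fun p => ?_⟩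
  rw [Bool.eq_iff_iff]
  simp only [sameColour, decide_eq_true_eq, f.injective.eq_iff]
  exact Quotient.eq

/-- The exchange of two adjacent strands. -/
abbrev adjSwap (k : Fin (n - 1)) : Equiv.Perm (Fin n) := Equiv.swap (lo k) (hi k)

theorem bConj_smul_prod (k : Fin (n - 1)) (f f' : Fin n × Fin n → TieAlg n)
    (h : ∀ p, bConj k • (f p : BT n) = f' p) (s : Finset (Fin n × Fin n)) :
    bConj k • ((∏ p ∈ s, f p : TieAlg n) : BT n) = (∏ p ∈ s, f' p : TieAlg n) := by
  classical
  induction s using Finset.induction_on with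
  | empty => exact smul_one _
  | insert p s hp ih =>
    rw [Finset.prod_insert hp, Finset.prod_insert hp]
    change bConj k • ((f p : BT n) * ((∏ p ∈ s, f p : TieAlg n) : BT n)) = _
    rw [smul_mul', h, ih]
    rfl

theorem bConj_smul_atom (k : Fin (n - 1)) (r : Fin n × Fin n → Bool) :
    bConj k • (atom r : BT n) = atom fun p => r (adjSwap k p.1, adjSwap k p.2) := by
  rw [atom, bConj_smul_prod k _ (fun p => if r p then tieElt (adjSwap k p.1, adjSwap k p.2)
    else 1 - tieElt (adjSwap k p.1, adjSwap k p.2)), atom]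
  · congr 1
    rw [← (Equiv.prodCongr (adjSwap k) (adjSwap k)).prod_comp]
    simp [Prod.map]
  · intro p
    split_ifs
    · exact bConj_smul_tie k _ _
    · change bConj k • (1 - tie p.1 p.2) = _
      rw [smul_sub, smul_one, bConj_smul_tie]
      rfl

/-- The idempotent of the partition of the strands into the classes of a colouring `χ`. -/
noncomputable def colourIdem (χ : Fin n → Fin d) : BT n := atom (sameColour χ)

theorem colourIdem_mul_self (χ : Fin n → Fin d) : colourIdem χ * colourIdem χ = colourIdem χ :=
  congrArg Subtype.val (atom_mul_self (sameColour χ))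

theorem b_mul_colourIdem (k : Fin (n - 1)) (χ : Fin n → Fin d) :
    b k * colourIdem χ = colourIdem (χ ∘ adjSwap k) * b k := by
  rw [← bConj_smul_eq_iff]
  exact bConj_smul_atom k _

theorem ε_mul_colourIdem (k : Fin (n - 1)) (χ : Fin n → Fin d) :
    ε k * colourIdem χ = if χ (lo k) = χ (hi k) then colourIdem χ else 0 := by
  have h := congrArg Subtype.val (tieElt_mul_atom (sameColour χ) (lo k, hi k))
  change tie (lo k) (hi k) * colourIdem χ = _ at h
  rw [tie_lo_hi] at h
  rw [h]
  simp only [sameColour, decide_eq_true_eq]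
  split_ifs <;> rfl

theorem colourIdem_mul_ε (k : Fin (n - 1)) (χ : Fin n → Fin d) :
    colourIdem χ * ε k = if χ (lo k) = χ (hi k) then colourIdem χ else 0 := by
  rw [← ε_mul_colourIdem, ← tie_lo_hi]
  exact congrArg Subtype.val (mul_comm (atom (sameColour χ)) (tieElt (lo k, hi k)))

/-- With at least `n` colours the idempotents of the colourings detect zero, also after passing to
another algebra. -/
theorem eq_zero_of_colourIdem_mul {A : Type} [Ring A] [Algebra K A] (hd : n ≤ d)
    (π : BT n →ₐ[K] A) (x : A) (h : ∀ χ : Fin n → Fin d, π (colourIdem χ) * x = 0) : x = 0 := by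
  have h1 : ∑ r : Fin n × Fin n → Bool, π (atom r : BT n) = 1 := by
    have := congrArg (fun y : TieAlg n => π (y : BT n)) (sum_atom (n := n))
    simpa using this
  rw [← one_mul x, ← h1, Finset.sum_mul]
  refine Finset.sum_eq_zero fun r _ => ?_
  by_cases hr : atom r = 0
  · rw [hr]; simp
  · obtain ⟨χ, rfl⟩ := exists_sameColour_of_atom_ne_zero hd r hr
    exact h χ

end BT

/-! ### The representation of the Yokonuma–Hecke algebra on coloured elements -/

/-- Orthogonality of the characters of the cyclic group of order `d`. -/
theorem avg_eq_ite {d a c : ℕ} {ζ : K} (hζ : IsPrimitiveRoot ζ d) (ha : a < d) (hc : c < d) :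
    avg d (ζ ^ a) (ζ ^ c) = if a = c then 1 else 0 := by
  have hp (a : ℕ) : (ζ ^ a) ^ d = 1 := by rw [← pow_mul, mul_comm, pow_mul, hζ.pow_eq_one, one_pow]
  split_ifs with h
  · subst h
    have hs : ∀ s ∈ Finset.range d, (ζ ^ a) ^ s * (ζ ^ a) ^ (d - s) = 1 := fun s hs => by
      rw [← pow_add, Nat.add_sub_cancel' (Finset.mem_range.1 hs).le, hp]
    have hd : (d : K) ≠ 0 := by exact_mod_cast (by omega : d ≠ 0)
    rw [avg, Finset.sum_congr rfl hs]
    simp [hd]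
  · have h1 := avg_mul_left_eq_avg_mul_right (Commute.all (ζ ^ a) (ζ ^ c)) (hp a) (hp c)
    by_contra h0
    exact h (hζ.pow_inj ha hc (mul_left_cancel₀ h0 h1))

theorem exists_isPrimitiveRoot {d : ℕ} (hd : d ≠ 0) : ∃ ζ : K, IsPrimitiveRoot ζ d :=
  ⟨algebraMap ℂ K _, (Complex.isPrimitiveRoot_exp d hd).map_of_injective
    (algebraMap ℂ K).injective⟩

theorem adjSwap_far {n : ℕ} (i j : Fin (n - 1)) (h : Far i j) :
    BT.adjSwap i * BT.adjSwap j = BT.adjSwap j * BT.adjSwap i := by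
  refine (Equiv.Perm.disjoint_swap_swap ?_).commute
  unfold Far at h
  simp only [List.nodup_cons, List.mem_cons, lo, hi, Fin.mk.injEq, List.not_mem_nil, or_false,
    not_false_eq_true, List.nodup_nil, and_true]
  omega

theorem adjSwap_braid {n : ℕ} (i j : Fin (n - 1)) (h : Near i j) :
    BT.adjSwap i * BT.adjSwap j * BT.adjSwap i = BT.adjSwap j * BT.adjSwap i * BT.adjSwap j := by
  obtain ⟨a, b, c, hab, hac, hbc, -, -, hi, hj⟩ := YH.exists_strands (d := 0) h
  rw [BT.adjSwap, BT.adjSwap, hi, hj, Equiv.swap_comm a b, Equiv.swap_comm b c,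
    Equiv.swap_mul_swap_mul_swap hbc.symm hac.symm, Equiv.swap_comm b a, Equiv.swap_comm c b,
    Equiv.swap_mul_swap_mul_swap hab hac, Equiv.swap_comm]

section Coloured

open BT

variable {n d : ℕ} {A : Type} [Ring A] [Algebra K A] (π : BT n →ₐ[K] A)

/-- Families indexed by the colourings `χ` of the strands with `d` colours, whose member at `χ` lies
in the right ideal of `A` generated by the idempotent of `χ`. -/
def Coloured (d : ℕ) : Submodule K ((Fin n → Fin d) → A) where
  carrier := {f | ∀ χ, π (colourIdem χ) * f χ = f χ}
  zero_mem' χ := mul_zero _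
  add_mem' hf hg χ := by rw [Pi.add_apply, mul_add, hf, hg]
  smul_mem' c f hf χ := by rw [Pi.smul_apply, mul_smul_comm, hf]

variable {π}

/-- `t_j` multiplies the member at `χ` by the root of unity `ζ ^ χ(j)`. -/
noncomputable def tOp (π : BT n →ₐ[K] A) (d : ℕ) (ζ : K) (j : Fin n) :
    Module.End K (Coloured π d) where
  toFun f := ⟨fun χ => ζ ^ (χ j : ℕ) • f.1 χ, fun χ => by rw [mul_smul_comm, f.2]⟩
  map_add' f g := by ext χ; exact smul_add _ _ _
  map_smul' c f := by ext χ; exact smul_comm _ _ _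

/-- `g_i` exchanges the colours of the strands `i`, `i + 1`, and multiplies by `b_i`. -/
noncomputable def gOp (π : BT n →ₐ[K] A) (d : ℕ) (i : Fin (n - 1)) :
    Module.End K (Coloured π d) where
  toFun f := ⟨fun χ => π (b i) * f.1 (χ ∘ adjSwap i), fun χ => by
    rw [← mul_assoc, ← map_mul, show colourIdem χ * b i = b i * colourIdem (χ ∘ adjSwap i) by
      rw [b_mul_colourIdem, Function.comp_assoc, ← Equiv.Perm.coe_mul, Equiv.swap_mul_self]; rfl,
      map_mul, mul_assoc, f.2]⟩
  map_add' f g := by ext χ; exact mul_add _ _ _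
  map_smul' c f := by ext χ; exact mul_smul_comm _ _ _

theorem tOp_apply (ζ : K) (j : Fin n) (f : Coloured π d) (χ : Fin n → Fin d) :
    (tOp π d ζ j f).1 χ = ζ ^ (χ j : ℕ) • f.1 χ := rfl

theorem gOp_apply (i : Fin (n - 1)) (f : Coloured π d) (χ : Fin n → Fin d) :
    (gOp π d i f).1 χ = π (b i) * f.1 (χ ∘ adjSwap i) := rfl

theorem tOp_pow_apply (ζ : K) (j : Fin n) (s : ℕ) (f : Coloured π d) (χ : Fin n → Fin d) :
    ((tOp π d ζ j ^ s) f).1 χ = (ζ ^ (χ j : ℕ)) ^ s • f.1 χ := by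
  induction s with
  | zero => simp
  | succ s ih => rw [pow_succ', Module.End.mul_apply, tOp_apply, ih, smul_smul, ← pow_succ']

theorem avg_tOp_apply {ζ : K} (hζ : IsPrimitiveRoot ζ d) (i j : Fin n) (f : Coloured π d)
    (χ : Fin n → Fin d) :
    (avg d (tOp π d ζ i) (tOp π d ζ j) f).1 χ = if χ i = χ j then f.1 χ else 0 := by
  have h1 : (avg d (tOp π d ζ i) (tOp π d ζ j) f).1 χ
      = avg d (ζ ^ (χ i : ℕ)) (ζ ^ (χ j : ℕ)) • f.1 χ := by
    simp only [avg, LinearMap.smul_apply, LinearMap.sum_apply, Module.End.mul_apply,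
      Submodule.coe_smul, Submodule.coe_sum, Pi.smul_apply, Finset.sum_apply, tOp_pow_apply,
      smul_smul, smul_eq_mul, Finset.sum_smul, Finset.mul_sum, Finset.smul_sum]
  rw [h1, avg_eq_ite hζ (χ i).2 (χ j).2]
  simp only [Fin.val_inj, ite_smul, one_smul, zero_smul]

theorem comp_adjSwap_of_eq {i : Fin (n - 1)} {χ : Fin n → Fin d} (h : χ (lo i) = χ (hi i)) :
    χ ∘ adjSwap i = χ := by
  funext a
  simp only [adjSwap, Function.comp, Equiv.swap_apply_def]
  split_ifs with h1 h2
  · rw [h1, h]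
  · rw [h2, h]
  · rfl

theorem comp_adjSwap_adjSwap (i : Fin (n - 1)) (χ : Fin n → Fin d) :
    (χ ∘ adjSwap i) ∘ adjSwap i = χ := by
  rw [Function.comp_assoc, ← Equiv.Perm.coe_mul, Equiv.swap_mul_self]; rfl

/-- On the member of a coloured family at `χ`, `ε_i` acts as `1` or as `0`, according to whether the
strands `i`, `i + 1` have the same colour. -/
theorem π_ε_mul (f : Coloured π d) (i : Fin (n - 1)) (χ : Fin n → Fin d) :
    π (ε i) * f.1 χ = if χ (lo i) = χ (hi i) then f.1 χ else 0 := by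
  rw [← f.2 χ, ← mul_assoc, ← map_mul, ε_mul_colourIdem]
  split_ifs
  · rfl
  · rw [map_zero, zero_mul]

/-- The representation of `Y_{d,n}(q)` on coloured families. -/
noncomputable def colouredRep (π : BT n →ₐ[K] A) {ζ : K} (hζ : IsPrimitiveRoot ζ d) :
    YH d n →ₐ[K] Module.End K (Coloured π d) :=
  RingQuot.liftAlgHom K ⟨FreeAlgebra.lift K fun
    | YHGen.g i => gOp π d i
    | YHGen.t j => tOp π d ζ j, by
    intro x y h
    induction h with
    | gg_far i j h =>
      simp only [map_mul, FreeAlgebra.lift_ι_apply]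
      refine LinearMap.ext fun f => Subtype.ext (funext fun χ => ?_)
      simp only [Module.End.mul_apply, gOp_apply, Function.comp_assoc, ← Equiv.Perm.coe_mul,
        ← mul_assoc, ← map_mul]
      rw [b_far i j h, adjSwap_far i j h]
    | braid i j h =>
      simp only [map_mul, FreeAlgebra.lift_ι_apply]
      refine LinearMap.ext fun f => Subtype.ext (funext fun χ => ?_)
      simp only [Module.End.mul_apply, gOp_apply, Function.comp_assoc, ← Equiv.Perm.coe_mul,
        ← mul_assoc, ← map_mul]
      rw [adjSwap_braid i j h]
      rcases h with h | h
      · rw [b_braid i j h]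
      · rw [b_braid j i h]
    | t_pow j =>
      simp only [map_pow, map_one, FreeAlgebra.lift_ι_apply]
      refine LinearMap.ext fun f => Subtype.ext (funext fun χ => ?_)
      rw [tOp_pow_apply, ← pow_mul, mul_comm, pow_mul, hζ.pow_eq_one, one_pow, one_smul]
      rfl
    | tt i j =>
      simp only [map_mul, FreeAlgebra.lift_ι_apply]
      refine LinearMap.ext fun f => Subtype.ext (funext fun χ => ?_)
      exact smul_comm _ _ _
    | gt i j =>
      simp only [map_mul, FreeAlgebra.lift_ι_apply]
      refine LinearMap.ext fun f => Subtype.ext (funext fun χ => ?_)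
      exact mul_smul_comm _ _ _
    | quadratic i =>
      simp only [map_pow, map_add, map_one, map_smul, map_mul, FreeAlgebra.lift_ι_apply]
      rw [map_avg (A := FreeAlgebra K (YHGen n)) (B := Module.End K (Coloured π d)),
        FreeAlgebra.lift_ι_apply, FreeAlgebra.lift_ι_apply, pow_two]
      refine LinearMap.ext fun f => Subtype.ext (funext fun χ => ?_)
      change π (b i) * (π (b i) * f.1 ((χ ∘ adjSwap i) ∘ adjSwap i))
        = f.1 χ + (q - q⁻¹) • (avg d (tOp π d ζ (lo i)) (tOp π d ζ (hi i)) (gOp π d i f)).1 χ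
      rw [avg_tOp_apply hζ, comp_adjSwap_adjSwap, ← mul_assoc, ← map_mul, b_sq, map_add, map_one,
        add_mul, one_mul, map_smul, smul_mul_assoc, ε_mul_b_self, map_mul, mul_assoc, π_ε_mul]
      split_ifs with h
      · rw [gOp_apply, comp_adjSwap_of_eq h]
      · rw [mul_zero]⟩

variable {ζ : K} (hζ : IsPrimitiveRoot ζ d)

theorem colouredRep_g (i : Fin (n - 1)) : colouredRep π hζ (YH.g d i) = gOp π d i := by
  simp [colouredRep, YH.g]

theorem colouredRep_t (j : Fin n) : colouredRep π hζ (YH.t d j) = tOp π d ζ j := by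
  simp [colouredRep, YH.t]

theorem colouredRep_e_apply (i : Fin (n - 1)) (f : Coloured π d) (χ : Fin n → Fin d) :
    (colouredRep π hζ (YH.e d i) f).1 χ = if χ (lo i) = χ (hi i) then f.1 χ else 0 := by
  rw [YH.e, map_avg (A := YH d n) (B := Module.End K (Coloured π d)),
    colouredRep_t, colouredRep_t, avg_tOp_apply hζ]

/-- If `ε₁ ε₂ b_{1,2}` vanishes in `A`, then `e₁ e₂ g_{1,2}` acts as zero: at a colouring for which
the first three strands have the same colour it acts as `ε₁ ε₂ b_{1,2}`, and `e₁ e₂` kills the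
members at all other colourings. -/
theorem colouredRep_tl (hn : 3 ≤ n) (hπ : π (BT.tl hn) = 0) :
    colouredRep π hζ (YH.tl d hn) = 0 := by
  refine LinearMap.ext fun f => Subtype.ext (funext fun χ => ?_)
  have hmul : YH.tl d hn = YH.e d (idx₁ hn) * (YH.e d (idx₂ hn) *
    (1 + q • (YH.g d (idx₁ hn) + YH.g d (idx₂ hn))
      + q ^ 2 • (YH.g d (idx₁ hn) * YH.g d (idx₂ hn) + YH.g d (idx₂ hn) * YH.g d (idx₁ hn))
      + q ^ 3 • (YH.g d (idx₁ hn) * YH.g d (idx₂ hn) * YH.g d (idx₁ hn)))) := by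
    rw [YH.tl, tlElement, mul_assoc]
  rw [hmul, map_mul, Module.End.mul_apply, colouredRep_e_apply]
  split_ifs with h1
  swap
  · rfl
  rw [map_mul, Module.End.mul_apply, colouredRep_e_apply]
  split_ifs with h2
  swap
  · rfl
  have key : ∀ y : Coloured π d, y.1 χ = π (ε (idx₁ hn)) * (π (ε (idx₂ hn)) * y.1 χ) := by
    intro y
    rw [π_ε_mul, if_pos h2, π_ε_mul, if_pos h1]
  have hχ : (χ ∘ adjSwap (idx₁ hn)) = χ := comp_adjSwap_of_eq h1
  have hχ' : (χ ∘ adjSwap (idx₂ hn)) = χ := comp_adjSwap_of_eq h2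
  rw [key]
  simp only [map_add, map_mul, map_smul, map_one, colouredRep_g, LinearMap.add_apply,
    LinearMap.smul_apply, Module.End.mul_apply, Module.End.one_apply, Submodule.coe_add,
    Submodule.coe_smul, Pi.add_apply, Pi.smul_apply, gOp_apply, hχ, hχ']
  have h3 : π (BT.tl hn) * f.1 χ = 0 := by rw [hπ, zero_mul]
  rw [BT.tl, map_tlElement, tlElement] at h3
  rw [← mul_assoc]
  change _ = (0 : A)
  rw [← h3]
  simp only [mul_assoc, add_mul, one_mul, smul_mul_assoc]

/-- The family `χ ↦ 1_χ x`, where `1_χ` is the idempotent of the colouring `χ`. -/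
noncomputable def spread (π : BT n →ₐ[K] A) (d : ℕ) : A →ₗ[K] Coloured π d where
  toFun x := ⟨fun χ => π (colourIdem χ) * x, fun χ => by
    rw [← mul_assoc, ← map_mul, colourIdem_mul_self]⟩
  map_add' x y := by ext χ; exact mul_add _ _ _
  map_smul' c x := by ext χ; exact mul_smul_comm _ _ _

theorem spread_apply (x : A) (χ : Fin n → Fin d) : (spread π d x).1 χ = π (colourIdem χ) * x := rfl

theorem spread_injective (hd : n ≤ d) : Function.Injective (spread π d) := by
  rw [injective_iff_map_eq_zero]
  intro x hx
  exact eq_zero_of_colourIdem_mul hd π x fun χ => congrFun (congrArg Subtype.val hx) χ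

/-- `spread` is linear over the algebra of braids and ties. -/
theorem colouredRep_toYH_spread (y : BT n) (x : A) :
    colouredRep π hζ (toYH d n y) (spread π d x) = spread π d (π y * x) := by
  induction y using BT.induction generalizing x with
  | scalar r =>
    rw [AlgHom.commutes, AlgHom.commutes, AlgHom.commutes, Module.algebraMap_end_apply,
      ← map_smul, Algebra.smul_def]
  | b i =>
    rw [toYH_b, colouredRep_g]
    refine Subtype.ext (funext fun χ => ?_)
    rw [gOp_apply, spread_apply, spread_apply, ← mul_assoc, ← mul_assoc, ← map_mul, ← map_mul,
      b_mul_colourIdem, comp_adjSwap_adjSwap]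
  | ε i =>
    rw [toYH_ε]
    refine Subtype.ext (funext fun χ => ?_)
    rw [colouredRep_e_apply, spread_apply, spread_apply, ← mul_assoc, ← map_mul, colourIdem_mul_ε]
    split_ifs
    · rfl
    · rw [map_zero, zero_mul]
  | add y z hy hz => rw [map_add, map_add, LinearMap.add_apply, hy, hz, map_add, add_mul, map_add]
  | mul y z hy hz => rw [map_mul, map_mul, Module.End.mul_apply, hz, hy, map_mul π, mul_assoc]

end Coloured

/-! ### The quotient algebras -/

section PrincipalQuotient

variable {A B : Type} [Ring A] [Algebra K A] [Ring B] [Algebra K B]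

/-- The homomorphism out of `A / ⟨x⟩` induced by a homomorphism killing `x`. -/
noncomputable def PrincipalQuotient.lift (x : A) (f : A →ₐ[K] B) (h : f x = 0) :
    PrincipalQuotient x →ₐ[K] B :=
  RingCon.liftₐ _ f (by
    have : TwoSidedIdeal.span {x} ≤ TwoSidedIdeal.ker f := by
      rw [TwoSidedIdeal.span_le, Set.singleton_subset_iff]
      exact (TwoSidedIdeal.mem_ker f).2 h
    exact TwoSidedIdeal.ringCon_le_iff.1 this)

theorem proj_surjective (x : A) : Function.Surjective (proj x) :=
  RingCon.mkₐ_surjective _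

theorem proj_self (x : A) : proj x x = 0 := by
  have h : x ∈ TwoSidedIdeal.span {x} := TwoSidedIdeal.subset_span rfl
  exact (RingCon.eq _).2 h

end PrincipalQuotient

/-! ### The partition Temperley–Lieb algebra inside the framization -/

section Framization

variable {d n : ℕ} (hn : 3 ≤ n)

/-- `E_n(q) → Y^{(br)}_{d,n}(q)`, `b_i ↦ g_i`, `ε_i ↦ e_i`. -/
noncomputable def toYHbr (d n : ℕ) : BT n →ₐ[K] YHbr d n :=
  (toYH d n).codRestrict (YHbr d n) fun x => by rw [← toYH_range]; exact ⟨x, rfl⟩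

theorem toYHbr_surjective : Function.Surjective (toYHbr d n) := by
  rintro ⟨y, hy⟩
  rw [← toYH_range] at hy
  obtain ⟨x, rfl⟩ := hy
  exact ⟨x, rfl⟩

theorem toYHbr_b (i : Fin (n - 1)) : toYHbr d n (BT.b i) = YHbr.g d i := Subtype.ext (toYH_b i)

theorem toYHbr_ε (i : Fin (n - 1)) : toYHbr d n (BT.ε i) = YHbr.e d i := Subtype.ext (toYH_ε i)

theorem toYHbr_tl : toYHbr d n (BT.tl hn) = YHbr.tl d hn := by
  refine (map_tlElement (A := BT n) (B := YHbr d n) (toYHbr d n)).trans ?_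
  rw [toYHbr_b, toYHbr_b, toYHbr_ε, toYHbr_ε, YHbr.tl]

theorem val_tl : (YHbr d n).val (YHbr.tl d hn) = YH.tl d hn := by
  exact map_tlElement (A := YHbr d n) (B := YH d n) (YHbr d n).val

/-- `PTL_n(q) → Y^{(br)}_{d,n}(q) / ⟨e₁ e₂ g_{1,2}⟩`. -/
noncomputable def toFTLbrQuot (d : ℕ) : PTL hn →ₐ[K] FTLbrQuot d hn :=
  PrincipalQuotient.lift _ ((proj (YHbr.tl d hn)).comp (toYHbr d n)) (by
    rw [AlgHom.comp_apply, toYHbr_tl, proj_self])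

/-- `Y^{(br)}_{d,n}(q) / ⟨e₁ e₂ g_{1,2}⟩ → FTL_{d,n}(q)`. -/
noncomputable def quotToFTL (d : ℕ) : FTLbrQuot d hn →ₐ[K] FTL d hn :=
  PrincipalQuotient.lift _ ((proj (YH.tl d hn)).comp (YHbr d n).val) (by
    rw [AlgHom.comp_apply, val_tl, proj_self])

theorem toFTLbrQuot_surjective : Function.Surjective (toFTLbrQuot hn d) := by
  intro y
  obtain ⟨y, rfl⟩ := proj_surjective _ y
  obtain ⟨x, rfl⟩ := toYHbr_surjective y
  exact ⟨proj _ x, rfl⟩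

theorem quotToFTL_comp_range : ((quotToFTL hn d).comp (toFTLbrQuot hn d)).range = FTLbr d hn := by
  have h : ((quotToFTL hn d).comp (toFTLbrQuot hn d)).range
      = (YHbr d n).map (proj (YH.tl d hn)) := by
    ext z
    constructor
    · rintro ⟨x, rfl⟩
      obtain ⟨x, rfl⟩ := proj_surjective _ x
      exact ⟨_, (toYHbr d n x).2, rfl⟩
    · rintro ⟨y, hy, rfl⟩
      obtain ⟨x, hx⟩ := toYHbr_surjective (d := d) ⟨y, hy⟩
      refine ⟨proj _ x, ?_⟩
      change proj (YH.tl d hn) (toYHbr d n x : YH d n) = _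
      rw [hx]
      rfl
  rw [h, YHbr, AlgHom.map_adjoin, ← Set.range_comp]
  rfl

/-- `PTL_n(q)` embeds into `FTL_{d,n}(q)`: the latter acts on the families with values in `PTL_n(q)`
coloured by `d ≥ n` colours, and `x` can be recovered from its action on the spread of `1`. -/
theorem quotToFTL_comp_injective (hd : n ≤ d) :
    Function.Injective ((quotToFTL hn d).comp (toFTLbrQuot hn d)) := by
  obtain ⟨ζ, hζ⟩ := exists_isPrimitiveRoot (d := d) (by omega)
  rw [injective_iff_map_eq_zero]
  intro x hx
  obtain ⟨x, rfl⟩ := proj_surjective _ x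
  let π : BT n →ₐ[K] PTL hn := proj (BT.tl hn)
  let ρ : FTL d hn →ₐ[K] Module.End K (Coloured π d) :=
    PrincipalQuotient.lift (B := Module.End K (Coloured π d)) _
      (colouredRep π hζ) (colouredRep_tl hζ hn (proj_self _))
  have h1 : colouredRep π hζ (toYH d n x) = 0 := by
    have := congrArg ρ hx
    rwa [map_zero] at this
  have h2 := colouredRep_toYH_spread (π := π) hζ x 1
  rw [h1, LinearMap.zero_apply, mul_one] at h2
  exact spread_injective hd (h2.symm.trans (map_zero _).symm)

end Framization

end BraidsTies

open BraidsTies in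
/-- For `d ≥ n ≥ 3`, `b_i ↦ g_i`, `ε_i ↦ e_i` induces isomorphisms `Φ` of `PTL_n(q)` onto the
quotient `Y^{(br)}_{d,n}(q) / ⟨e₁ e₂ g_{1,2}⟩` and `Ψ` of `PTL_n(q)` onto the subalgebra of
`FTL_{d,n}(q)` generated by the `g_i`. The resulting identification `Ψ ∘ Φ⁻¹` of the two forms of
`FTL^{(br)}_{d,n}(q)` is the one induced by the projection `Y_{d,n}(q) → FTL_{d,n}(q)`. -/
theorem mainTheorem1 (d n : ℕ) (hn : 3 ≤ n) (hd : n ≤ d) :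
    ∃ (Φ : PTL hn ≃ₐ[K] FTLbrQuot d hn) (Ψ : PTL hn ≃ₐ[K] FTLbr d hn),
      (∀ i : Fin (n - 1),
        Φ (proj (BT.tl hn) (BT.b i)) = proj (YHbr.tl d hn) (YHbr.g d i) ∧
        Φ (proj (BT.tl hn) (BT.ε i)) = proj (YHbr.tl d hn) (YHbr.e d i)) ∧
      (∀ i : Fin (n - 1),
        (Ψ (proj (BT.tl hn) (BT.b i)) : FTL d hn) = proj (YH.tl d hn) (YH.g d i) ∧
        (Ψ (proj (BT.tl hn) (BT.ε i)) : FTL d hn) = proj (YH.tl d hn) (YH.e d i)) ∧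
      (∀ y : YHbr d n,
        (Ψ (Φ.symm (proj (YHbr.tl d hn) y)) : FTL d hn) = proj (YH.tl d hn) (y : YH d n)) := by
  have hinj := quotToFTL_comp_injective hn hd
  have hinj' : Function.Injective (toFTLbrQuot hn d) :=
    Function.Injective.of_comp (f := quotToFTL hn d) hinj
  let Φ := AlgEquiv.ofBijective (toFTLbrQuot hn d) ⟨hinj', toFTLbrQuot_surjective hn⟩
  let Ψ := (AlgEquiv.ofInjective _ hinj).trans (Subalgebra.equivOfEq _ _ (quotToFTL_comp_range hn))
  have hΨ (x : PTL hn) : (Ψ x : FTL d hn) = quotToFTL hn d (Φ x) := rfl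
  have hΦb (i : Fin (n - 1)) :
      Φ (proj (BT.tl hn) (BT.b i)) = proj (YHbr.tl d hn) (YHbr.g d i) :=
    congrArg (proj (YHbr.tl d hn)) (toYHbr_b i)
  have hΦε (i : Fin (n - 1)) :
      Φ (proj (BT.tl hn) (BT.ε i)) = proj (YHbr.tl d hn) (YHbr.e d i) :=
    congrArg (proj (YHbr.tl d hn)) (toYHbr_ε i)
  refine ⟨Φ, Ψ, fun i => ⟨hΦb i, hΦε i⟩, fun i => ⟨?_, ?_⟩, fun y => ?_⟩
  · rw [hΨ, hΦb]; rfl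
  · rw [hΨ, hΦε]; rfl
  · rw [hΨ, AlgEquiv.apply_symm_apply]; rfl
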